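/- Conventions. A simplicial category $\mathsf{A}$ consists of categories $\mathsf{A}_n$ ($n\ge 0$) of $n$-arrows with a common set of objects, assembled into a functor $\Delta^{\mathrm{op}}\to\mathsf{Cat}$ of identity-on-objects functors. An arrow of a category is atomic if it is not an identity and if, in every factorization of it as a composite of two arrows, one of the two factors is an identity. $\mathsf{A}$ is a simplicial computad if (i) for each $n$, every non-identity $n$-arrow is uniquely a composite of atomic $n$-arrows, and (ii) for every atomic $n$-arrow $f$ and every epimorphism $\alpha\colon[m]\twoheadrightarrow[n]$ of $\Delta$, the $m$-arrow $f\cdot\alpha$ is atomic. An $n$-arrow is non-degenerate if it is not of the form $g\cdot\alpha$ with $g$ an $m$-arrow, $m<n$. Let $\mathfrak{C}[k]$ be the simplicial category with objects $0,\dots,k$ whose mapping space from $i$ to $j$ is the nerve of the poset, ordered by inclusion, of subsets of $[i,j]=\{t: i\le t\le j\}$ that contain $i$ and $j$ (empty if $j<i$), with composition given by union; thus an $n$-arrow from $0$ to $k$ is a chain $T^n\subseteq\cdots\subseteq T^0$ of subsets of $[0,k]$ containing $0$ and $k$, the $i$-th vertex of the corresponding $n$-simplex being $T^{n-i}$. For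 a simplicial set $X$, the homotopy coherent realization $\mathfrak{C}X$ is the value at $X$ of the pointwise left Kan extension of $[k]\mapsto\mathfrak{C}[k]$ along the Yoneda embedding, i.e. the colimit of the $\mathfrak{C}[k]$ indexed by the category of simplices of $X$; so each $k$-simplex $\sigma$ of $X$ gives a simplicial functor $\sigma_*\colon\mathfrak{C}[k]\to\mathfrak{C}X$. Proposition. For any simplicial set $X$, its homotopy coherent realization $\mathfrak{C}X$ is a simplicial computad in which: 1. the objects are the vertices of $X$, i.e. $X_0\to\mathrm{ob}\,\mathfrak{C}X$ is a bijection; 2. the atomic $0$-arrows are the non-degenerate $1$-simplices of $X$; 3. the non-degenerate atomic $1$-arrows are the non-degenerate $k$-simplices of $X$ with $k>1$ (the simplex $\sigma$ corresponding to the image under $\sigma_*$ of $\{0,k\}=T^1\subsetneq T^0=[0,k]$); 4. for each $n\ge0$, the non-degenerate atomic $n$-arrows are the pairs of a non-degenerate $k$-simplex $\sigma$ of $X$, for some $k>n$, and a flag of proper inclusions $$\{0,k\}=T^n\subsetneq T^{n-1}\subsetneq\cdots\subsetneq T^0=[0,k],$$ the pair $(\sigma,T)$ corresponding to the $n$-arrow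 $\sigma_*(T)$. Likewise the atomic $n$-arrows, degenerate or not, are the pairs of a non-degenerate $k$-simplex $\sigma$, $k>0$, and a flag $\{0,k\}=T^n\subseteq\cdots\subseteq T^0=[0,k]$ of not necessarily proper inclusions. The source of each such arrow is the initial vertex of the simplex, and its target is the final vertex. Moreover, for $k>n$, the $n$-arrows from $0$ to $k$ of $\mathfrak{C}[k]$ given by flags of proper inclusions as in (4) are exactly those that are atomic, non-degenerate and not in the image of any of the face maps $\mathfrak{C}[k-1]\to\mathfrak{C}[k]$. -/

import Mathlib

open CategoryTheory Opposite

universe u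

noncomputable section

namespace HomotopyCoherent

/-! ### Atomic arrows and freely generated categories -/

/-- An arrow is an identity. -/
inductive IsIdentity {C : Type*} [Category C] : ∀ {x y : C}, (x ⟶ y) → Prop
  | id (x : C) : IsIdentity (𝟙 x)

/-- An arrow is atomic if it is not an identity and if, whenever it is factored as a composite
of two arrows, one of the two factors is an identity. -/
def IsAtomic {C : Type*} [Category C] {x y : C} (f : x ⟶ y) : Prop :=
  ¬ IsIdentity f ∧ ∀ (z : C) (g : x ⟶ z) (h : z ⟶ y), g ≫ h = f → IsIdentity g ∨ IsIdentity h

/-- The objects of `C`, as the vertices of the directed graph of atomic arrows of `C`. -/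
structure AtomicGraph (C : Type*) where
  as : C

instance (C : Type*) [Category C] : Quiver (AtomicGraph C) where
  Hom x y := {f : x.as ⟶ y.as // IsAtomic f}

/-- The inclusion of the graph of atomic arrows of `C` in `C`. -/
def AtomicGraph.inclusion (C : Type*) [Category C] : AtomicGraph C ⥤q C where
  obj x := x.as
  map f := f.1

/-- `C` is freely generated by its atomic arrows: every non-identity arrow is the composite
of a unique path of atomic arrows. -/
def IsFreelyGeneratedByAtomics (C : Type*) [Category C] : Prop :=
  ∀ (x y : C) (f : x ⟶ y), ¬ IsIdentity f →
    ∃! p : Quiver.Path (AtomicGraph.mk x) (AtomicGraph.mk y),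
      composePath ((AtomicGraph.inclusion C).mapPath p) = f

/-! ### Simplicial categories -/

open Simplicial

/-- A simplicial object in categories `[n] ↦ Aₙ` is a simplicial category if all the categories
`Aₙ` have the same objects, i.e. if all simplicial operators are bijective on objects. -/
def IsSimplicialCat : ObjectProperty (SimplexCategoryᵒᵖ ⥤ Cat.{u, u}) :=
  fun A ↦ ∀ ⦃m n : SimplexCategoryᵒᵖ⦄ (α : m ⟶ n), Function.Bijective (A.map α).toFunctor.obj

/-- The category of (small) simplicial categories and simplicial functors. -/
abbrev SCat : Type (u + 1) := IsSimplicialCat.{u}.FullSubcategory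

/-- The category `Aₙ` of `n`-arrows of a simplicial category. -/
abbrev SCat.level (A : SCat.{u}) (n : ℕ) : Cat.{u, u} := A.obj.obj (op ⦋n⦌)

/-- The degenerated, or more generally reindexed, `m`-arrow `f · α`. -/
abbrev SCat.act (A : SCat.{u}) {m n : ℕ} (α : ⦋m⦌ ⟶ ⦋n⦌) {x y : A.level n} (f : x ⟶ y) :=
  (A.obj.map α.op).toFunctor.map f

/-- The functor `Aₙ ⥤ Bₙ` on `n`-arrows underlying a simplicial functor `A ⟶ B`. -/
abbrev SCat.levelMap {A B : SCat.{u}} (F : A ⟶ B) (n : ℕ) : A.level n ⥤ B.level n :=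
  (F.hom.app (op ⦋n⦌)).toFunctor

/-- The simplicial set whose `n`-simplices are all the `n`-arrows of `A`, i.e. the disjoint union
of all mapping spaces of `A`. -/
def SCat.arrows (A : SCat.{u}) : SSet.{u} where
  obj n := Arrow (A.obj.obj n)
  map α := ↾(A.obj.map α).toFunctor.mapArrow.obj
  map_id n := by
    ext f
    exact Functor.congr_obj
      (congrArg Functor.mapArrow (congrArg Cat.Hom.toFunctor (A.obj.map_id n))) f
  map_comp α β := by
    ext f
    exact Functor.congr_obj
      (congrArg Functor.mapArrow (congrArg Cat.Hom.toFunctor (A.obj.map_comp α β))) f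

/-- An `n`-arrow is non-degenerate if it is not of the form `g · α` for an `m`-arrow `g`
with `m < n`. -/
def SCat.nonDegenerateArrows (A : SCat.{u}) (n : ℕ) : Set (Arrow (A.level n)) :=
  A.arrows.nonDegenerate n

/-- The set of atomic `n`-arrows. -/
def SCat.atomicArrows (A : SCat.{u}) (n : ℕ) : Set (Arrow (A.level n)) :=
  {f | IsAtomic f.hom}

/-- A simplicial category is a simplicial computad if each category of `n`-arrows is freely
generated by the atomic `n`-arrows and degenerated atomic arrows are atomic. -/
structure IsSimplicialComputad (A : SCat.{u}) : Prop where
  freely_generated (n : ℕ) : IsFreelyGeneratedByAtomics (A.level n)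
  atomic_degenerated {m n : ℕ} (α : ⦋m⦌ ⟶ ⦋n⦌) [Epi α] {x y : A.level n} (f : x ⟶ y)
    (hf : IsAtomic f) : IsAtomic (A.act α f)

/-! ### Simplicial categories have colimits -/

/-- The codiscrete category on a type. -/
structure Codisc (A : Type u) : Type u where
  as : A

instance (A : Type u) : Category.{u} (Codisc A) where
  Hom _ _ := PUnit
  id _ := ⟨⟩
  comp _ _ := ⟨⟩

def codisc : Type u ⥤ Cat.{u, u} where
  obj A := Cat.of (Codisc A)
  map f := Functor.toCatHom { obj x := ⟨f x.as⟩, map _ := ⟨⟩ }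

def objectsAdj : Cat.objects.{u, u} ⊣ codisc.{u} := Adjunction.mkOfHomEquiv {
  homEquiv C A :=
    { toFun f := Functor.toCatHom (C := C) (D := Codisc A) { obj x := ⟨f x⟩, map _ := ⟨⟩ }
      invFun F := ↾fun x ↦ (F.toFunctor.obj x).as
      left_inv _ := rfl
      right_inv _ := rfl }
  homEquiv_naturality_left_symm _ _ := rfl
  homEquiv_naturality_right _ _ := rfl }

instance : Limits.PreservesColimitsOfSize.{u, u} Cat.objects.{u, u} :=
  objectsAdj.leftAdjoint_preservesColimits

lemma isSimplicialCat_iff (A : SimplexCategoryᵒᵖ ⥤ Cat.{u, u}) :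
    IsSimplicialCat A ↔ ∀ ⦃m n : SimplexCategoryᵒᵖ⦄ (α : m ⟶ n),
      IsIso ((A ⋙ Cat.objects).map α) :=
  forall_congr' fun _ ↦ forall_congr' fun _ ↦ forall_congr' fun α ↦
    (isIso_iff_bijective ((A ⋙ Cat.objects).map α)).symm

instance (J : Type u) [Category.{u} J] : IsSimplicialCat.{u}.IsClosedUnderColimitsOfShape J where
  colimitsOfShape_le := by
    rintro A ⟨h⟩
    rw [isSimplicialCat_iff]
    intro m n α
    let G : SimplexCategoryᵒᵖ → (SimplexCategoryᵒᵖ ⥤ Cat.{u, u}) ⥤ Type u :=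
      fun k ↦ (evaluation SimplexCategoryᵒᵖ Cat.{u, u}).obj k ⋙ Cat.objects
    let τ : G m ⟶ G n :=
      Functor.whiskerRight ((evaluation SimplexCategoryᵒᵖ Cat.{u, u}).map α) Cat.objects
    have key : ∀ j, IsIso (τ.app (h.diag.obj j)) := fun j ↦
      (isSimplicialCat_iff _).1 (h.prop_diag_obj j) α
    let hm := Limits.isColimitOfPreserves (G m) h.isColimit
    let hn := Limits.isColimitOfPreserves (G n) h.isColimit
    have (j : J) : IsIso ((Functor.whiskerLeft h.diag τ).app j) := key j
    have : IsIso (Functor.whiskerLeft h.diag τ) :=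
      NatIso.isIso_of_isIso_app (Functor.whiskerLeft h.diag τ)
    let e := hm.coconePointsIsoOfNatIso hn (asIso (Functor.whiskerLeft h.diag τ))
    have he : e.hom = τ.app A := hm.hom_ext fun j ↦ by
      rw [hm.comp_coconePointsIsoOfNatIso_hom hn]
      exact (τ.naturality (h.ι.app j)).symm
    change IsIso (τ.app A)
    rw [← he]
    infer_instance

instance : Limits.HasColimits SCat.{u} where
  has_colimits_of_shape _ _ := inferInstance

instance : Limits.HasColimitsOfSize.{0, u} SCat.{u} :=
  Limits.hasColimitsOfSizeShrink.{0, u, u, u} SCat.{u}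

/-! ### Homotopy coherent simplices -/

section Level

variable (C : Type u) [EnrichedCategory SSet.{u} C]

structure Level (n : SimplexCategoryᵒᵖ) : Type u where
  as : C

instance (n : SimplexCategoryᵒᵖ) : Category.{u} (Level C n) where
  Hom x y := (x.as ⟶[SSet.{u}] y.as).obj n
  id x := (eId SSet.{u} x.as).app n PUnit.unit
  comp {x y z} f g := (eComp SSet.{u} x.as y.as z.as).app n (f, g)
  id_comp {x y} f := congrArg (fun φ ↦ φ.app n f) (e_id_comp SSet.{u} x.as y.as)
  comp_id {x y} f := congrArg (fun φ ↦ φ.app n f) (e_comp_id SSet.{u} x.as y.as)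
  assoc {w x y z} f g h :=
    (congrArg (fun φ ↦ φ.app n (f, (g, h))) (e_assoc SSet.{u} w.as x.as y.as z.as))

/-- The simplicial operators on the categories of `n`-arrows of `C`. -/
def Level.act {m n : SimplexCategoryᵒᵖ} (α : m ⟶ n) : Level C m ⥤ Level C n where
  obj x := ⟨x.as⟩
  map {x y} f := (x.as ⟶[SSet.{u}] y.as).map α f
  map_id x := (NatTrans.naturality_apply (eId SSet.{u} x.as) α PUnit.unit).symm
  map_comp {x y z} f g :=
    (congrArg (fun φ ↦ φ (f, g)) ((eComp SSet.{u} x.as y.as z.as).naturality α)).symm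

/-- The simplicial category `[n] ↦ Cₙ` of a simplicially enriched category `C`: the `n`-arrows
from `x` to `y` are the `n`-simplices of the mapping space from `x` to `y`. -/
def toSCat : SCat.{u} where
  obj :=
    { obj n := Cat.of (Level C n)
      map α := (Level.act C α).toCatHom
      map_id n := Cat.ext (CategoryTheory.Functor.hext (fun _ ↦ rfl) fun x y f ↦
        heq_of_eq (congrArg (fun φ ↦ φ f) ((x.as ⟶[SSet.{u}] y.as).map_id n)))
      map_comp α β := Cat.ext (CategoryTheory.Functor.hext (fun _ ↦ rfl) fun x y f ↦
        heq_of_eq (congrArg (fun φ ↦ φ f) ((x.as ⟶[SSet.{u}] y.as).map_comp α β))) }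
  property m n α := ⟨fun x y h ↦ by cases x; cases y; cases h; rfl, fun x ↦ ⟨⟨x.as⟩, rfl⟩⟩

variable {C} {D : Type u} [EnrichedCategory SSet.{u} D] (F : EnrichedFunctor SSet.{u} C D)

/-- The functor on `n`-arrows given by a simplicially enriched functor. -/
def Level.map (n : SimplexCategoryᵒᵖ) : Level C n ⥤ Level D n where
  obj x := ⟨F.obj x.as⟩
  map {x y} f := (F.map x.as y.as).app n f
  map_id x := congrArg (fun φ ↦ φ.app n PUnit.unit) (F.map_id x.as)
  map_comp {x y z} f g := congrArg (fun φ ↦ φ.app n (f, g)) (F.map_comp x.as y.as z.as)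

/-- The simplicial functor given by a simplicially enriched functor. -/
def toSCatMap : toSCat C ⟶ toSCat D where
  hom :=
    { app n := (Level.map F n).toCatHom
      naturality _ _ α := Cat.ext (CategoryTheory.Functor.hext (fun _ ↦ rfl) fun x y f ↦
        heq_of_eq (congrArg (fun φ ↦ φ f) ((F.map x.as y.as).naturality α))) }

end Level

/-- The homotopy coherent simplices `ℭ[k]`, as a cosimplicial object in simplicial categories.
The objects of `ℭ[k]` are the elements of `[k]`, and the mapping space from `i` to `j` is the
nerve of the poset, ordered by inclusion, of all subsets of `{t | i ≤ t ≤ j}` containing `i` and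
`j` (it is empty if `j < i`); composition is given by unions. -/
def coherentSimplex : SimplexCategory ⥤ SCat.{u} where
  obj k := toSCat (SimplicialThickening (ULift.{u} (Fin (k.len + 1))))
  map θ := toSCatMap (SimplicialThickening.functor θ.toOrderHom.uliftMap)
  map_id k := by
    change toSCatMap (SimplicialThickening.functor OrderHom.id) = _
    rw [SimplicialThickening.functor_id]
    rfl
  map_comp θ η := by
    change toSCatMap (SimplicialThickening.functor
      (η.toOrderHom.uliftMap.comp θ.toOrderHom.uliftMap)) = _
    rw [SimplicialThickening.functor_comp]
    rfl

/-- The object `i` of `ℭ[k]`, in the category of `n`-arrows. -/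
def coherentSimplex.vertex (n : ℕ) {k : ℕ} (i : Fin (k + 1)) :
    (coherentSimplex.{u}.obj ⦋k⦌).level n :=
  Level.mk (SimplicialThickening.mk (ULift.up i))

/-! ### Homotopy coherent realization -/

/-- The Yoneda embedding `[k] ↦ Δ[k]`. -/
def yonedaEmbedding : SimplexCategory ⥤ SSet.{u} where
  obj k := SSet.stdSimplex.{u}.obj k
  map θ := SSet.stdSimplex.{u}.map θ
  map_id k := SSet.stdSimplex.{u}.map_id k
  map_comp θ η := SSet.stdSimplex.{u}.map_comp θ η

instance : yonedaEmbedding.{u}.HasPointwiseLeftKanExtension coherentSimplex.{u} :=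
  fun _ ↦ inferInstance

/-- The homotopy coherent realization `X ↦ ℭX`, the (pointwise) left Kan extension of
`[k] ↦ ℭ[k]` along the Yoneda embedding: `ℭX` is the colimit of the homotopy coherent simplices
indexed by the category of simplices of `X`. -/
def realization : SSet.{u} ⥤ SCat.{u} :=
  yonedaEmbedding.{u}.leftKanExtension coherentSimplex.{u}

variable {X : SSet.{u}}

/-- The simplicial functor `ℭ[k] ≅ ℭΔ[k] ⟶ ℭX` given by a `k`-simplex of `X`. -/
def simplexMap {k : ℕ} (σ : X _⦋k⦌) : coherentSimplex.{u}.obj ⦋k⦌ ⟶ realization.obj X :=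
  (yonedaEmbedding.{u}.leftKanExtensionUnit coherentSimplex.{u}).app ⦋k⦌ ≫
    realization.map (SSet.yonedaEquiv.symm σ)

/-- The object of `ℭX` given by a vertex of `X`, in the category of `n`-arrows. -/
def vertexObj (n : ℕ) (x : X _⦋0⦌) : (realization.obj X).level n :=
  (SCat.levelMap (simplexMap x) n).obj (coherentSimplex.vertex n 0)

/-- The `i`-th vertex of a `k`-simplex. -/
def simplexVertex {k : ℕ} (σ : X _⦋k⦌) (i : Fin (k + 1)) : X _⦋0⦌ :=
  X.map (SimplexCategory.const ⦋0⦌ ⦋k⦌ i).op σ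

/-! ### Flags of vertex data -/

/-- A flag `{0, k} = Tⁿ ⊆ ⋯ ⊆ T¹ ⊆ T⁰ = [0, k]`. -/
structure Flag (n k : ℕ) where
  T : Fin (n + 1) → Set (Fin (k + 1))
  antitone : Antitone T
  last_eq : T (Fin.last n) = {0, Fin.last k}
  zero_eq : T 0 = Set.univ

/-- All the inclusions `{0, k} = Tⁿ ⊊ ⋯ ⊊ T¹ ⊊ T⁰ = [0, k]` are proper. -/
def Flag.IsProper {n k : ℕ} (T : Flag n k) : Prop := StrictAnti T.T

/-- The only flag `{0, 1} = T⁰ = [0, 1]`. -/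
def Flag.ofEdge : Flag 0 1 where
  T _ := Set.univ
  antitone _ _ _ := le_rfl
  last_eq := by
    ext i
    fin_cases i <;> simp
  zero_eq := rfl

/-- The only flag `{0, k} = T¹ ⊆ T⁰ = [0, k]`. -/
def Flag.ofSimplex (k : ℕ) : Flag 1 k where
  T := ![Set.univ, {0, Fin.last k}]
  antitone i j h := by
    fin_cases i <;> fin_cases j <;> simp at h ⊢
  last_eq := rfl
  zero_eq := rfl

/-- The `n`-arrow of `ℭ[k]` from `0` to `k` given by the chain `Tⁿ ⊆ ⋯ ⊆ T¹ ⊆ T⁰`: the `i`-th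
vertex of this `n`-simplex of the nerve is `Tⁿ⁻ⁱ`. -/
def Flag.arrow {n k : ℕ} (T : Flag n k) :
    coherentSimplex.vertex.{u} n (0 : Fin (k + 1)) ⟶ coherentSimplex.vertex n (Fin.last k) :=
  show ComposableArrows
      (SimplicialThickening.mk (ULift.up.{u} (0 : Fin (k + 1))) ⟶
        SimplicialThickening.mk (ULift.up.{u} (Fin.last k))) n from
  { obj i :=
      { I := ULift.down ⁻¹' T.T i.rev
        left := by
          have h := T.antitone (Fin.le_last i.rev)
          rw [T.last_eq] at h
          exact h (Or.inl rfl)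
        right := by
          have h := T.antitone (Fin.le_last i.rev)
          rw [T.last_eq] at h
          exact h (Or.inr rfl)
        left_le j _ := Fin.zero_le j.down
        le_right j _ := Fin.le_last j.down }
    map {i j} h := ⟨⟨⟨Set.preimage_mono (T.antitone (Fin.rev_le_rev.2 h.le))⟩⟩⟩ }

/-- The `n`-arrow of `ℭX` given by a `k`-simplex of `X` and a flag. -/
def simplexArrow {n k : ℕ} (σ : X _⦋k⦌) (T : Flag n k) : Arrow ((realization.obj X).level n) :=
  Arrow.mk ((SCat.levelMap (simplexMap σ) n).map T.arrow)

/-- A simplex of `X`, together with a flag of length `n` of vertex data. -/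
structure Bead (X : SSet.{u}) (n : ℕ) where
  dim : ℕ
  simplex : X _⦋dim⦌
  flag : Flag n dim

/-- The `n`-arrow of `ℭX` given by a bead. -/
def Bead.arrow {n : ℕ} (b : Bead X n) : Arrow ((realization.obj X).level n) :=
  simplexArrow b.simplex b.flag

end HomotopyCoherent
end

noncomputable section

namespace HomotopyCoherent

open Simplicial

/-! ### Freely generated categories -/

section Free

variable {C : Type*} [Category C] {D : Type*} [Category D]

/-! Colimits of simplicial categories are computed levelwise, so the category of `n`-arrows of `ℭX`
is the colimit, over the simplices of `X`, of the categories of `n`-arrows of `ℭ[k]`. The latter are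
free: an arrow is an increasing chain of subsets whose minimum is the source and whose maximum is
the target, and it factors exactly at the elements of its smallest subset. Hence the atomic arrows
are those non-identities whose smallest subset consists of the two endpoints alone. A simplicial
operator sends an atomic arrow to an atomic arrow or to an identity, so the colimit should be free
on the atomic arrows, suitably identified.

The identification is made by a normal form. An atomic arrow `f` of `ℭ[k]` is the image of a flag
along the injection enumerating the largest subset of `f`. Restrict the simplex `σ` of `X` along
this injection, write the result as a degeneracy of a non-degenerate simplex (Eilenberg-Zilber), and
push the flag forward along that degeneracy. The resulting bead is unique (`Represents.unique`) and
compatible with simplicial operators (`Represents.map`). The functors from `ℭ[k]` to the free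
category `BeadCat` on the non-degenerate beads of positive dimension therefore form a cocone. The
induced functor `toBeads` has the inverse `ofBeads`, and the atomic arrows of `ℭX` are exactly these
beads (`bijOn_atomic`).

A degeneracy operator repeats subsets of the flag and leaves the simplex alone. So degenerated
atomic arrows are atomic, and a bead is non-degenerate exactly when its flag is proper
(`bead_arrow_mem_nonDegenerateArrows_iff`). Counting elements along a proper flag gives `n < k`, and
for `n ≤ 1` the flag is forced. -/

lemma IsIdentity.map {x y : C} {f : x ⟶ y} (hf : IsIdentity f) (F : C ⥤ D) :
    IsIdentity (F.map f) := by
  obtain ⟨⟩ := hf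
  rw [F.map_id]
  exact .id _

/-- Equalities between arrows whose endpoints agree only propositionally are stated throughout in
`Arrow`, which avoids transports. -/
lemma isIdentity_of_arrow_eq {x y x' y' : C} {f : x ⟶ y} {g : x' ⟶ y'}
    (h : Arrow.mk f = Arrow.mk g) (hf : IsIdentity f) : IsIdentity g := by
  cases h
  exact hf

lemma isAtomic_of_arrow_eq {x y x' y' : C} {f : x ⟶ y} {g : x' ⟶ y'}
    (h : Arrow.mk f = Arrow.mk g) (hf : IsAtomic f) : IsAtomic g := by
  cases h
  exact hf

lemma heq_of_arrow_eq {x y x' y' : C} {f : x ⟶ y} {g : x' ⟶ y'}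
    (h : Arrow.mk f = Arrow.mk g) : f ≍ g := by
  cases h
  rfl

lemma arrow_comp_congr {x y z x' y' z' : C} {f : x ⟶ y} {g : y ⟶ z} {f' : x' ⟶ y'} {g' : y' ⟶ z'}
    (hf : Arrow.mk f = Arrow.mk f') (hg : Arrow.mk g = Arrow.mk g') :
    Arrow.mk (f ≫ g) = Arrow.mk (f' ≫ g') := by
  cases hf
  obtain rfl : z = z' := congrArg (fun a : Arrow C ↦ a.right) hg
  obtain rfl := Arrow.mk_injective _ _ hg
  rfl

/-- Functors which agree on arrows, as elements of the type of all arrows, are equal. -/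
lemma functor_ext_arrow {F G : C ⥤ D}
    (h : ∀ ⦃x y : C⦄ (f : x ⟶ y), Arrow.mk (F.map f) = Arrow.mk (G.map f)) : F = G :=
  CategoryTheory.Functor.hext
    (fun x ↦ congrArg (fun a : Arrow D ↦ a.left) (h (𝟙 x)))
    fun _ _ f ↦ heq_of_arrow_eq (h f)

lemma arrow_map_congr (F : C ⥤ D) {x y x' y' : C} {f : x ⟶ y} {g : x' ⟶ y'}
    (h : Arrow.mk f = Arrow.mk g) : Arrow.mk (F.map f) = Arrow.mk (F.map g) :=
  congrArg F.mapArrow.obj h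

lemma arrow_mk_eqToHom_comp {x y z w : C} (h : x = y) (f : y ⟶ z) (h' : z = w) :
    Arrow.mk (eqToHom h ≫ f ≫ eqToHom h') = Arrow.mk f := by
  subst h h'
  simp

lemma arrow_map_inj {F : C ⥤ D} {G : D ⥤ C} (hFG : F ⋙ G = 𝟭 C) {x y x' y' : C}
    {f : x ⟶ y} {g : x' ⟶ y'} (h : Arrow.mk (F.map f) = Arrow.mk (F.map g)) :
    Arrow.mk f = Arrow.mk g := by
  have h1 (a : Arrow C) : G.mapArrow.obj (F.mapArrow.obj a) = a :=
    Functor.congr_obj (congrArg Functor.mapArrow hFG) a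
  rw [← h1 (Arrow.mk f), ← h1 (Arrow.mk g)]
  exact congrArg G.mapArrow.obj h

lemma isIdentity_map_iff {F : C ⥤ D} {G : D ⥤ C} (hFG : F ⋙ G = 𝟭 C) {x y : C} (f : x ⟶ y) :
    IsIdentity (F.map f) ↔ IsIdentity f := by
  refine ⟨fun h ↦ ?_, fun h ↦ h.map F⟩
  refine isIdentity_of_arrow_eq ?_ (h.map G)
  exact Functor.congr_obj (congrArg Functor.mapArrow hFG) (Arrow.mk f)

/-- A functor with a left inverse reflects identities, so a factorization of `f` can be tested on
its image. -/
lemma isAtomic_of_isAtomic_map {F : C ⥤ D} {G : D ⥤ C} (hFG : F ⋙ G = 𝟭 C) {x y : C} {f : x ⟶ y}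
    (hf : IsAtomic (F.map f)) : IsAtomic f := by
  refine ⟨fun h ↦ hf.1 (h.map F), fun z g h e ↦ ?_⟩
  have := hf.2 _ (F.map g) (F.map h) (by rw [← F.map_comp, e])
  rwa [isIdentity_map_iff hFG, isIdentity_map_iff hFG] at this

lemma isAtomic_map_iff {F : C ⥤ D} {G : D ⥤ C} (hFG : F ⋙ G = 𝟭 C) (hGF : G ⋙ F = 𝟭 D)
    {x y : C} (f : x ⟶ y) : IsAtomic (F.map f) ↔ IsAtomic f := by
  refine ⟨isAtomic_of_isAtomic_map hFG, fun h ↦ isAtomic_of_isAtomic_map hGF ?_⟩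
  refine isAtomic_of_arrow_eq ?_ h
  exact (Functor.congr_obj (congrArg Functor.mapArrow hFG) (Arrow.mk f)).symm

variable (C) in
/-- A criterion for a category to be freely generated by its atomic arrows: non-trivial factors
are shorter, and last atomic factors are unique. -/
structure FreeCriterion : Prop where
  exists_length : ∃ ℓ : Arrow C → ℕ, ∀ ⦃x y z : C⦄ (f : x ⟶ y) (g : y ⟶ z),
    ¬ IsIdentity f → ¬ IsIdentity g →
      ℓ (Arrow.mk f) < ℓ (Arrow.mk (f ≫ g)) ∧ ℓ (Arrow.mk g) < ℓ (Arrow.mk (f ≫ g))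
  isIdentity_of_comp ⦃x y z : C⦄ (f : x ⟶ y) (g : y ⟶ z) : IsIdentity (f ≫ g) → IsIdentity g
  cancel ⦃x y y' z : C⦄ (f : x ⟶ y) (g : y ⟶ z) (f' : x ⟶ y') (g' : y' ⟶ z) :
    IsAtomic g → IsAtomic g' → f ≫ g = f' ≫ g' →
      Arrow.mk f = Arrow.mk f' ∧ Arrow.mk g = Arrow.mk g'

/-- The composite of a path of atomic arrows. -/
abbrev composeAtomics {x y : C} (p : Quiver.Path (AtomicGraph.mk x) (AtomicGraph.mk y)) : x ⟶ y :=
  composePath ((AtomicGraph.inclusion C).mapPath p)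

lemma composeAtomics_comp {x y z : C} (p : Quiver.Path (AtomicGraph.mk x) (AtomicGraph.mk y))
    (q : Quiver.Path (AtomicGraph.mk y) (AtomicGraph.mk z)) :
    composeAtomics (p.comp q) = composeAtomics p ≫ composeAtomics q := by
  rw [composeAtomics, Prefunctor.mapPath_comp]
  exact composePath_comp _ _

namespace FreeCriterion

variable (hC : FreeCriterion C)
include hC

/-- Strong induction on the length: an arrow that is neither an identity nor atomic splits into two
strictly shorter ones. -/
lemma exists_path {x y : C} (f : x ⟶ y) :
    ∃ p : Quiver.Path (AtomicGraph.mk x) (AtomicGraph.mk y), composeAtomics p = f := by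
  obtain ⟨ℓ, hℓ⟩ := hC.exists_length
  generalize hn : ℓ (Arrow.mk f) = n
  induction n using Nat.strong_induction_on generalizing x y with
  | _ n ih =>
    by_cases h1 : IsIdentity f
    · obtain ⟨⟩ := h1
      exact ⟨.nil, rfl⟩
    by_cases h2 : IsAtomic f
    · exact ⟨Quiver.Hom.toPath (V := AtomicGraph C) ⟨f, h2⟩, Category.id_comp _⟩
    · simp only [IsAtomic, h1, not_false_eq_true, true_and, not_forall, not_or] at h2
      obtain ⟨z, g, h, rfl, hg, hh⟩ := h2
      obtain ⟨l1, l2⟩ := hℓ g h hg hh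
      obtain ⟨p, hp⟩ := ih _ (hn ▸ l1) g rfl
      obtain ⟨q, hq⟩ := ih _ (hn ▸ l2) h rfl
      exact ⟨p.comp q, by rw [composeAtomics_comp, hp, hq]⟩

/-- The paths are compared from their last arrows, which agree by `cancel`. An identity cannot end
in an atomic arrow, which rules out an empty path against a non-empty one. -/
lemma path_unique {x y : AtomicGraph C} (p q : Quiver.Path x y)
    (h : composeAtomics p = composeAtomics q) : p = q := by
  induction p with
  | nil =>
    cases q with
    | nil => rfl
    | cons q e =>
      have : IsIdentity (composeAtomics q ≫ e.1) := by
        rw [show composeAtomics q ≫ e.1 = 𝟙 x.as from h.symm]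
        exact .id _
      exact (e.2.1 (hC.isIdentity_of_comp _ _ this)).elim
  | @cons y z p e ih =>
    cases q with
    | nil =>
      have : IsIdentity (composeAtomics p ≫ e.1) := by
        rw [show composeAtomics p ≫ e.1 = 𝟙 x.as from h]
        exact .id _
      exact (e.2.1 (hC.isIdentity_of_comp _ _ this)).elim
    | @cons y' _ q e' =>
      obtain ⟨h1, h2⟩ := hC.cancel _ _ _ _ e.2 e'.2 h
      obtain ⟨y⟩ := y
      obtain ⟨y'⟩ := y'
      obtain rfl : y = y' := congrArg (fun a : Arrow C ↦ a.right) h1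
      obtain rfl := ih q (Arrow.mk_injective _ _ h1)
      obtain rfl : e = e' := Subtype.ext (Arrow.mk_injective _ _ h2)
      rfl

lemma existsUnique_path {x y : C} (f : x ⟶ y) :
    ∃! p : Quiver.Path (AtomicGraph.mk x) (AtomicGraph.mk y), composeAtomics p = f := by
  obtain ⟨p, hp⟩ := hC.exists_path f
  exact ⟨p, hp, fun q hq ↦ hC.path_unique q p (hq.trans hp.symm)⟩

lemma isFreelyGeneratedByAtomics : IsFreelyGeneratedByAtomics C :=
  fun _ _ f _ ↦ hC.existsUnique_path f

/-- The path of atomic arrows whose composite is a given arrow. -/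
def path {x y : C} (f : x ⟶ y) : Quiver.Path (AtomicGraph.mk x) (AtomicGraph.mk y) :=
  (hC.existsUnique_path f).exists.choose

lemma composeAtomics_path {x y : C} (f : x ⟶ y) : composeAtomics (hC.path f) = f :=
  (hC.existsUnique_path f).exists.choose_spec

lemma path_eq {x y : C} (f : x ⟶ y) (p : Quiver.Path (AtomicGraph.mk x) (AtomicGraph.mk y))
    (hp : composeAtomics p = f) : hC.path f = p :=
  hC.path_unique _ _ ((hC.composeAtomics_path f).trans hp.symm)

/-- The functor with given values on the atomic arrows. -/
def lift (φ : AtomicGraph C ⥤q D) : C ⥤ D where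
  obj x := φ.obj ⟨x⟩
  map f := composePath (φ.mapPath (hC.path f))
  map_id x := by
    rw [hC.path_eq (𝟙 x) .nil rfl]
    rfl
  map_comp f g := by
    rw [hC.path_eq (f ≫ g) ((hC.path f).comp (hC.path g))
      (by rw [composeAtomics_comp, hC.composeAtomics_path, hC.composeAtomics_path]),
      Prefunctor.mapPath_comp]
    exact composePath_comp _ _

lemma lift_map_of_isAtomic (φ : AtomicGraph C ⥤q D) {x y : C} (f : x ⟶ y) (hf : IsAtomic f) :
    (hC.lift φ).map f = φ.map (X := ⟨x⟩) (Y := ⟨y⟩) ⟨f, hf⟩ := by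
  dsimp only [lift]
  rw [hC.path_eq f (Quiver.Hom.toPath (V := AtomicGraph C) (a := ⟨x⟩) (b := ⟨y⟩) ⟨f, hf⟩)
    (Category.id_comp _)]
  exact Category.id_comp _

lemma functor_ext {F G : C ⥤ D} (hobj : ∀ x, F.obj x = G.obj x)
    (h : ∀ ⦃x y : C⦄ (f : x ⟶ y), IsAtomic f → Arrow.mk (F.map f) = Arrow.mk (G.map f)) :
    F = G := by
  refine functor_ext_arrow fun x y f ↦ ?_
  obtain ⟨p, rfl⟩ := hC.exists_path f
  suffices ∀ {x y : AtomicGraph C} (p : Quiver.Path x y),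
      Arrow.mk (F.map (composeAtomics p)) = Arrow.mk (G.map (composeAtomics p)) from this p
  intro x y p
  induction p with
  | nil =>
    change Arrow.mk (F.map (𝟙 _)) = Arrow.mk (G.map (𝟙 _))
    -- Agreement on objects is needed only here, since the empty path involves no atomic arrow.
    rw [F.map_id, G.map_id, hobj]
  | cons p e ih =>
    change Arrow.mk (F.map (composeAtomics p ≫ e.1)) = Arrow.mk (G.map (composeAtomics p ≫ e.1))
    rw [F.map_comp, G.map_comp]
    exact arrow_comp_congr ih (h e.1 e.2)

end FreeCriterion

lemma FreeCriterion.of_inverse {F : C ⥤ D} {G : D ⥤ C} (hFG : F ⋙ G = 𝟭 C) (hGF : G ⋙ F = 𝟭 D)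
    (hD : FreeCriterion D) : FreeCriterion C where
  exists_length := by
    obtain ⟨ℓ, hℓ⟩ := hD.exists_length
    refine ⟨fun a ↦ ℓ (F.mapArrow.obj a), fun x y z f g hf hg ↦ ?_⟩
    have := hℓ (F.map f) (F.map g) (by rwa [isIdentity_map_iff hFG])
      (by rwa [isIdentity_map_iff hFG])
    rwa [← F.map_comp] at this
  isIdentity_of_comp x y z f g h := by
    rw [← isIdentity_map_iff hFG] at h ⊢
    rw [F.map_comp] at h
    exact hD.isIdentity_of_comp _ _ h
  cancel x y y' z f g f' g' hg hg' h := by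
    obtain ⟨h1, h2⟩ := hD.cancel (F.map f) (F.map g) (F.map f') (F.map g')
      ((isAtomic_map_iff hFG hGF _).2 hg) ((isAtomic_map_iff hFG hGF _).2 hg')
      (by rw [← F.map_comp, ← F.map_comp, h])
    exact ⟨arrow_map_inj hFG h1, arrow_map_inj hFG h2⟩

end Free

/-! ### Path categories are freely generated by their edges -/

section Paths

variable {V : Type*} [Quiver V]

lemma paths_isIdentity_iff {x y : V} (f : Quiver.Path x y) :
    IsIdentity (C := Paths V) (x := x) (y := y) f ↔ f.length = 0 := by
  constructor
  · rintro ⟨⟩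
    rfl
  · intro h
    cases f with
    | nil => exact .id (C := Paths V) _
    | cons p e => simp at h

lemma paths_isAtomic_iff {x y : V} (f : Quiver.Path x y) :
    IsAtomic (C := Paths V) (x := x) (y := y) f ↔ ∃ e : x ⟶ y, f = e.toPath := by
  constructor
  · intro hf
    cases f with
    | nil => exact (hf.1 (.id (C := Paths V) _)).elim
    | cons p e =>
      rcases hf.2 _ p e.toPath rfl with h | h
      · have := (paths_isIdentity_iff p).1 h
        cases p with
        | nil => exact ⟨e, rfl⟩
        | cons => simp at this
      · cases (paths_isIdentity_iff e.toPath).1 h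
  · rintro ⟨e, rfl⟩
    refine ⟨fun h ↦ ?_, fun z g h e' ↦ ?_⟩
    · cases (paths_isIdentity_iff e.toPath).1 h
    · have := congrArg Quiver.Path.length (show Quiver.Path.comp (V := V) g h = e.toPath from e')
      have h1 := (Quiver.Path.length_comp (V := V) g h).symm.trans this
      rw [Quiver.Path.length_toPath] at h1
      rw [show IsIdentity g ↔ _ from paths_isIdentity_iff (V := V) g,
        show IsIdentity h ↔ _ from paths_isIdentity_iff (V := V) h]
      omega

lemma paths_freeCriterion : FreeCriterion (Paths V) where
  exists_length := by
    refine ⟨fun a ↦ Quiver.Path.length (V := V) a.hom, fun x y z f g hf hg ↦ ?_⟩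
    have h1 := mt (paths_isIdentity_iff (V := V) f).2 hf
    have h2 := mt (paths_isIdentity_iff (V := V) g).2 hg
    have : Quiver.Path.length (V := V) (f ≫ g) = _ := Quiver.Path.length_comp (V := V) f g
    dsimp
    omega
  isIdentity_of_comp x y z f g h := by
    have h1 := (paths_isIdentity_iff (V := V) (f ≫ g)).1 h
    have : Quiver.Path.length (V := V) (f ≫ g) = _ := Quiver.Path.length_comp (V := V) f g
    exact (paths_isIdentity_iff (V := V) g).2 (by omega)
  cancel x y y' z f g f' g' hg hg' h := by
    obtain ⟨e, rfl⟩ := (paths_isAtomic_iff (V := V) g).1 hg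
    obtain ⟨e', rfl⟩ := (paths_isAtomic_iff (V := V) g').1 hg'
    have h' : Quiver.Path.cons (V := V) f e = Quiver.Path.cons f' e' := h
    cases h'
    exact ⟨rfl, rfl⟩

end Paths

/-! ### Arrows of the homotopy coherent simplices as chains of subsets -/

section Chains

variable {n k : ℕ}

/-- The element of `[k]` corresponding to an object of `ℭ[k]`. -/
def idx (x : (coherentSimplex.{u}.obj ⦋k⦌).level n) : Fin (k + 1) := x.as.as.down

/-- The subsets of `[k]` constituting an `n`-arrow of `ℭ[k]`, in increasing order. -/
def carr {x y : (coherentSimplex.{u}.obj ⦋k⦌).level n} (f : x ⟶ y) (i : Fin (n + 1)) :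
    Set (Fin (k + 1)) :=
  ULift.up ⁻¹' ((show ComposableArrows (x.as ⟶ y.as) n from f).obj i).I

lemma vertex_idx (x : (coherentSimplex.{u}.obj ⦋k⦌).level n) :
    coherentSimplex.vertex n (idx x) = x := rfl

lemma idx_vertex (i : Fin (k + 1)) : idx (coherentSimplex.vertex.{u} n i) = i := rfl

lemma idx_injective : Function.Injective (idx.{u} (n := n) (k := k)) := fun x y h ↦
  (vertex_idx x).symm.trans ((congrArg (coherentSimplex.vertex n) h).trans (vertex_idx y))

variable {x y z : (coherentSimplex.{u}.obj ⦋k⦌).level n}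

lemma left_mem_carr (f : x ⟶ y) (i : Fin (n + 1)) : idx x ∈ carr f i :=
  ((show ComposableArrows (x.as ⟶ y.as) n from f).obj i).left

lemma right_mem_carr (f : x ⟶ y) (i : Fin (n + 1)) : idx y ∈ carr f i :=
  ((show ComposableArrows (x.as ⟶ y.as) n from f).obj i).right

lemma left_le_of_mem_carr (f : x ⟶ y) {i : Fin (n + 1)} {t : Fin (k + 1)} (h : t ∈ carr f i) :
    idx x ≤ t :=
  ((show ComposableArrows (x.as ⟶ y.as) n from f).obj i).left_le _ h

lemma le_right_of_mem_carr (f : x ⟶ y) {i : Fin (n + 1)} {t : Fin (k + 1)} (h : t ∈ carr f i) :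
    t ≤ idx y :=
  ((show ComposableArrows (x.as ⟶ y.as) n from f).obj i).le_right _ h

lemma carr_monotone (f : x ⟶ y) : Monotone (carr f) := fun _ _ h ↦
  Set.preimage_mono ((show ComposableArrows (x.as ⟶ y.as) n from f).map (homOfLE h)).1.1.1

lemma idx_le (f : x ⟶ y) : idx x ≤ idx y := left_le_of_mem_carr f (right_mem_carr f 0)

/-- A simplex of the nerve of a poset is determined by its vertices. -/
lemma carr_ext {f g : x ⟶ y} (h : ∀ i, carr f i = carr g i) : f = g := by
  have hobj (i : Fin (n + 1)) : (show ComposableArrows (x.as ⟶ y.as) n from f).obj i =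
      (show ComposableArrows (x.as ⟶ y.as) n from g).obj i :=
    SimplicialThickening.Path.ext (Set.ext fun t ↦ Set.ext_iff.1 (h i) t.down)
  exact CategoryTheory.Functor.ext (F := (show ComposableArrows (x.as ⟶ y.as) n from f))
    (G := (show ComposableArrows (x.as ⟶ y.as) n from g)) hobj fun i j e ↦ rfl

/-- The `n`-arrow of `ℭ[k]` given by an increasing sequence of subsets. -/
def mkArrow (x y : (coherentSimplex.{u}.obj ⦋k⦌).level n) (S : Fin (n + 1) → Set (Fin (k + 1)))
    (hS : Monotone S) (hx : idx x ∈ S 0) (hy : idx y ∈ S 0)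
    (h : ∀ t ∈ S (Fin.last n), idx x ≤ t ∧ t ≤ idx y) : x ⟶ y :=
  show ComposableArrows (x.as ⟶ y.as) n from
  { obj i :=
      { I := ULift.down ⁻¹' S i
        left := hS (Fin.zero_le i) hx
        right := hS (Fin.zero_le i) hy
        left_le j hj := (h j.down (hS (Fin.le_last i) hj)).1
        le_right j hj := (h j.down (hS (Fin.le_last i) hj)).2 }
    map {i j} h := ⟨⟨⟨Set.preimage_mono (hS h.le)⟩⟩⟩ }

lemma carr_comp (f : x ⟶ y) (g : y ⟶ z) (i : Fin (n + 1)) :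
    carr (f ≫ g) i = carr f i ∪ carr g i := rfl

lemma carr_id (x : (coherentSimplex.{u}.obj ⦋k⦌).level n) (i : Fin (n + 1)) :
    carr (𝟙 x) i = {idx x} := by
  ext t
  exact ULift.up_inj

lemma carr_map {l : ℕ} (θ : ⦋k⦌ ⟶ ⦋l⦌) (f : x ⟶ y) (i : Fin (n + 1)) :
    carr ((SCat.levelMap (coherentSimplex.map θ) n).map f) i = θ.toOrderHom '' carr f i := by
  ext t
  constructor
  · rintro ⟨s, hs, h⟩
    exact ⟨s.down, hs, congrArg ULift.down h⟩
  · rintro ⟨s, hs, rfl⟩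
    exact ⟨⟨s⟩, hs, rfl⟩

lemma carr_act {m : ℕ} (α : ⦋m⦌ ⟶ ⦋n⦌) (f : x ⟶ y) (i : Fin (m + 1)) :
    carr (SCat.act (coherentSimplex.obj ⦋k⦌) α f) i = carr f (α.toOrderHom i) := rfl

lemma carr_arrow (T : Flag n k) (i : Fin (n + 1)) : carr T.arrow.{u} i = T.T i.rev := rfl

/-- An `n`-arrow of `ℭ[k]` is determined by the corresponding subsets of `[k]`. -/
lemma arrow_ext {x y x' y' : (coherentSimplex.{u}.obj ⦋k⦌).level n} {f : x ⟶ y} {g : x' ⟶ y'}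
    (h : ∀ i, carr f i = carr g i) : Arrow.mk f = Arrow.mk g := by
  -- The source is the least element of each subset, and the target is the greatest.
  obtain rfl : x = x' := idx_injective (le_antisymm
    (left_le_of_mem_carr f ((h 0).symm ▸ left_mem_carr g 0))
    (left_le_of_mem_carr g (h 0 ▸ left_mem_carr f 0)))
  obtain rfl : y = y' := idx_injective (le_antisymm
    (le_right_of_mem_carr g (h 0 ▸ right_mem_carr f 0))
    (le_right_of_mem_carr f ((h 0).symm ▸ right_mem_carr g 0)))
  rw [carr_ext h]

lemma carr_eq_of_arrow_eq {x y x' y' : (coherentSimplex.{u}.obj ⦋k⦌).level n} {f : x ⟶ y}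
    {g : x' ⟶ y'} (h : Arrow.mk f = Arrow.mk g) (i : Fin (n + 1)) : carr f i = carr g i := by
  cases h
  rfl

end Chains

/-! ### Atomic arrows and free generation of `ℭ[k]` -/

section Atomic

variable {n k : ℕ} {x y z : (coherentSimplex.{u}.obj ⦋k⦌).level n}

lemma coherent_isIdentity_iff (f : x ⟶ y) : IsIdentity f ↔ idx x = idx y := by
  refine ⟨fun h ↦ by cases h; rfl, fun h ↦ ?_⟩
  obtain rfl := idx_injective h
  have : f = 𝟙 x := carr_ext fun i ↦ by
    rw [carr_id]
    exact Set.Subset.antisymm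
      (fun t ht ↦ le_antisymm (le_right_of_mem_carr f ht) (left_le_of_mem_carr f ht))
      (Set.singleton_subset_iff.2 (left_mem_carr f i))
  rw [this]
  exact .id x

lemma coherent_not_isIdentity_iff (f : x ⟶ y) : ¬ IsIdentity f ↔ idx x < idx y := by
  rw [coherent_isIdentity_iff, (idx_le f).lt_iff_ne]

/-- An element of the smallest subset lies in every subset, so the whole chain can be cut at `t`. -/
lemma exists_factorization (f : x ⟶ y) {t : Fin (k + 1)} (ht : t ∈ carr f 0) :
    ∃ (g : x ⟶ coherentSimplex.vertex n t) (h : coherentSimplex.vertex n t ⟶ y), g ≫ h = f := by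
  have hm := carr_monotone f
  refine ⟨mkArrow x _ (fun i ↦ carr f i ∩ Set.Iic t)
      (fun i j h ↦ Set.inter_subset_inter_left _ (hm h))
      ⟨left_mem_carr f 0, left_le_of_mem_carr f ht⟩ ⟨ht, Set.mem_Iic.2 (le_refl t)⟩
      (fun s hs ↦ ⟨left_le_of_mem_carr f hs.1, hs.2⟩),
    mkArrow _ y (fun i ↦ carr f i ∩ Set.Ici t)
      (fun i j h ↦ Set.inter_subset_inter_left _ (hm h))
      ⟨ht, Set.mem_Ici.2 (le_refl t)⟩ ⟨right_mem_carr f 0, le_right_of_mem_carr f ht⟩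
      (fun s hs ↦ ⟨hs.2, le_right_of_mem_carr f hs.1⟩), carr_ext fun i ↦ ?_⟩
  change (carr f i ∩ Set.Iic t) ∪ (carr f i ∩ Set.Ici t) = _
  rw [← Set.inter_union_distrib_left,
    Set.Iic_union_Ici, Set.inter_univ]

lemma coherent_isAtomic_iff (f : x ⟶ y) :
    IsAtomic f ↔ idx x < idx y ∧ carr f 0 = {idx x, idx y} := by
  constructor
  · intro hf
    refine ⟨(coherent_not_isIdentity_iff f).1 hf.1, Set.Subset.antisymm (fun t ht ↦ ?_) ?_⟩
    · obtain ⟨g, h, e⟩ := exists_factorization f ht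
      rcases hf.2 _ g h e with h | h
      · exact Or.inl ((coherent_isIdentity_iff _).1 h).symm
      · exact Or.inr ((coherent_isIdentity_iff _).1 h)
    · rintro t (rfl | rfl)
      exacts [left_mem_carr f 0, right_mem_carr f 0]
  · rintro ⟨hxy, h0⟩
    refine ⟨(coherent_not_isIdentity_iff f).2 hxy, ?_⟩
    rintro z g h rfl
    have : idx z ∈ carr (g ≫ h) 0 := Or.inl (right_mem_carr g 0)
    rw [h0] at this
    rw [coherent_isIdentity_iff, coherent_isIdentity_iff]
    rcases this with h | h
    exacts [Or.inl h.symm, Or.inr h]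

/-- The object `y` lies in the smallest subset of the common composite. Beyond `y'` that subset
contains only `z`, which differs from `y` because `g` is atomic. -/
lemma idx_le_of_isAtomic {y' : (coherentSimplex.{u}.obj ⦋k⦌).level n}
    (f : x ⟶ y) (g : y ⟶ z) (f' : x ⟶ y') (g' : y' ⟶ z)
    (hg : IsAtomic g) (hg' : IsAtomic g') (h : f ≫ g = f' ≫ g') : idx y ≤ idx y' := by
  rw [coherent_isAtomic_iff] at hg hg'
  have : idx y ∈ carr (f' ≫ g') 0 := h ▸ Or.inl (right_mem_carr f 0)
  rw [carr_comp, hg'.2] at this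
  rcases this with h | h | h
  · exact le_right_of_mem_carr f' h
  · exact h.le
  · exact absurd h hg.1.ne

lemma carr_left_factor (f : x ⟶ y) (g : y ⟶ z) (i : Fin (n + 1)) :
    carr f i = carr (f ≫ g) i ∩ Set.Iic (idx y) := by
  ext t
  refine ⟨fun h ↦ ⟨Or.inl h, le_right_of_mem_carr f h⟩, ?_⟩
  rintro ⟨h | h, h'⟩
  · exact h
  · rw [le_antisymm h' (left_le_of_mem_carr g h)]
    exact right_mem_carr f i

lemma carr_right_factor (f : x ⟶ y) (g : y ⟶ z) (i : Fin (n + 1)) :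
    carr g i = carr (f ≫ g) i ∩ Set.Ici (idx y) := by
  ext t
  refine ⟨fun h ↦ ⟨Or.inr h, left_le_of_mem_carr g h⟩, ?_⟩
  rintro ⟨h | h, h'⟩
  · rw [le_antisymm (le_right_of_mem_carr f h) h']
    exact left_mem_carr g i
  · exact h

/-- The category of `n`-arrows of `ℭ[k]` is freely generated by its atomic arrows. -/
lemma coherent_freeCriterion (n k : ℕ) : FreeCriterion ((coherentSimplex.{u}.obj ⦋k⦌).level n) where
  exists_length := by
    refine ⟨fun a ↦ (idx a.right).val - (idx a.left).val, fun x y z f g hf hg ↦ ?_⟩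
    rw [coherent_not_isIdentity_iff, Fin.lt_def] at hf hg
    dsimp
    omega
  isIdentity_of_comp x y z f g h := by
    rw [coherent_isIdentity_iff] at *
    exact le_antisymm (idx_le g) (h ▸ idx_le f)
  cancel x y y' z f g f' g' hg hg' h := by
    obtain rfl : y = y' := idx_injective (le_antisymm
      (idx_le_of_isAtomic f g f' g' hg hg' h) (idx_le_of_isAtomic f' g' f g hg' hg h.symm))
    refine ⟨arrow_ext fun i ↦ ?_, arrow_ext fun i ↦ ?_⟩
    · rw [carr_left_factor f g, carr_left_factor f' g', h]
    · rw [carr_right_factor f g, carr_right_factor f' g', h]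

end Atomic

/-! ### Degenerate arrows -/

section Degenerate

variable {A B : SCat.{u}} {n : ℕ}

lemma mem_nonDegenerateArrows_iff {x y : A.level n} (f : x ⟶ y) :
    Arrow.mk f ∈ A.nonDegenerateArrows n ↔
      ∀ ⦃m : ℕ⦄, m < n → ∀ (α : ⦋n⦌ ⟶ ⦋m⦌) [Epi α] ⦃x' y' : A.level m⦄ (g : x' ⟶ y'),
        Arrow.mk (A.act α g) ≠ Arrow.mk f := by
  refine (not_congr (A.arrows.mem_degenerate_iff (n := n) (Arrow.mk f))).trans ?_
  constructor
  · intro h m hm α hα x' y' g e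
    exact h ⟨m, hm, α, hα, Arrow.mk g, e⟩
  · rintro h ⟨m, hm, α, hα, g, e⟩
    exact h hm α g.hom e

lemma SCat.levelMap_act (F : A ⟶ B) {m n : ℕ} (α : ⦋m⦌ ⟶ ⦋n⦌) {x y : A.level n} (f : x ⟶ y) :
    Arrow.mk ((SCat.levelMap F m).map (A.act α f)) =
      Arrow.mk (B.act α ((SCat.levelMap F n).map f)) :=
  Functor.congr_obj (congrArg Functor.mapArrow
    (congrArg Cat.Hom.toFunctor (F.hom.naturality α.op))) (Arrow.mk f)

/-- Simplicial functors carry degenerate arrows to degenerate arrows. -/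
lemma nonDegenerate_of_map (F : A ⟶ B) {x y : A.level n} (f : x ⟶ y)
    (h : Arrow.mk ((SCat.levelMap F n).map f) ∈ B.nonDegenerateArrows n) :
    Arrow.mk f ∈ A.nonDegenerateArrows n := by
  rw [mem_nonDegenerateArrows_iff] at *
  intro m hm α hα x' y' g e
  refine h hm α ((SCat.levelMap F m).map g) ?_
  rw [← SCat.levelMap_act]
  exact arrow_map_congr _ e

lemma SCat.act_act (A : SCat.{u}) {l m n : ℕ} (β : ⦋l⦌ ⟶ ⦋m⦌) (α : ⦋m⦌ ⟶ ⦋n⦌) {x y : A.level n}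
    (f : x ⟶ y) : Arrow.mk (A.act β (A.act α f)) = Arrow.mk (A.act (β ≫ α) f) :=
  (Functor.congr_obj (congrArg Functor.mapArrow
    (congrArg Cat.Hom.toFunctor (A.obj.map_comp α.op β.op))) (Arrow.mk f)).symm

lemma SCat.act_id (A : SCat.{u}) {x y : A.level n} (f : x ⟶ y) :
    Arrow.mk (A.act (𝟙 _) f) = Arrow.mk f :=
  Functor.congr_obj (congrArg Functor.mapArrow
    (congrArg Cat.Hom.toFunctor (A.obj.map_id (op ⦋n⦌)))) (Arrow.mk f)

/-- If a degenerated arrow is atomic, then so is the original arrow. -/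
lemma isAtomic_of_act {m : ℕ} (α : ⦋m⦌ ⟶ ⦋n⦌) [Epi α] {x y : A.level n} (f : x ⟶ y)
    (hf : IsAtomic (A.act α f)) : IsAtomic f := by
  have key : ∀ {x y : A.level n} (f : x ⟶ y), IsIdentity (A.act α f) → IsIdentity f := by
    intro x y f h
    -- Acting by a section of `α` recovers `f` from `f · α`.
    have : IsSplitEpi α := isSplitEpi_of_epi α
    refine isIdentity_of_arrow_eq ?_ (h.map (A.obj.map (section_ α).op).toFunctor)
    refine (SCat.act_act A _ _ f).trans ?_
    rw [IsSplitEpi.id]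
    exact SCat.act_id A f
  refine ⟨fun h ↦ hf.1 (h.map _), fun z g h e ↦ ?_⟩
  refine (hf.2 _ (A.act α g) (A.act α h) ?_).imp (key g) (key h)
  exact (Functor.map_comp _ _ _).symm.trans (congrArg _ e)

lemma toOrderHom_surjective {m n : ℕ} (α : ⦋m⦌ ⟶ ⦋n⦌) [Epi α] :
    Function.Surjective α.toOrderHom :=
  SimplexCategory.epi_iff_surjective.1 inferInstance

lemma toOrderHom_zero {m n : ℕ} (α : ⦋m⦌ ⟶ ⦋n⦌) [Epi α] : α.toOrderHom (0 : Fin (m + 1)) =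
    (0 : Fin (n + 1)) := by
  obtain ⟨i, hi⟩ := toOrderHom_surjective α (0 : Fin (n + 1))
  exact le_antisymm (hi ▸ α.toOrderHom.monotone (show (0 : Fin (m + 1)) ≤ i from Fin.zero_le _)) (Fin.zero_le _)

lemma toOrderHom_last {m n : ℕ} (α : ⦋m⦌ ⟶ ⦋n⦌) [Epi α] :
    α.toOrderHom (Fin.last m) = Fin.last n := by
  obtain ⟨i, hi⟩ := toOrderHom_surjective α (Fin.last n)
  exact le_antisymm (Fin.le_last _) (hi ▸ α.toOrderHom.monotone (show i ≤ Fin.last m from Fin.le_last _))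

/-- As in the nerve of any poset, a chain is degenerate exactly when it repeats a vertex. -/
lemma coherent_mem_nonDegenerate_iff {k : ℕ} {x y : (coherentSimplex.{u}.obj ⦋k⦌).level n}
    (f : x ⟶ y) : Arrow.mk f ∈ (coherentSimplex.obj ⦋k⦌).nonDegenerateArrows n ↔
      StrictMono (carr f) := by
  rw [mem_nonDegenerateArrows_iff]
  constructor
  · intro h
    cases n with
    | zero => exact fun i j h ↦ by omega
    | succ n =>
      rw [Fin.strictMono_iff_lt_succ]
      intro i
      refine lt_of_le_of_ne (carr_monotone f (Fin.castSucc_lt_succ).le) fun e ↦ ?_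
      -- If the subsets at positions `i` and `i + 1` agree, then `f` is recovered by deleting
      -- position `i + 1` and repeating position `i`.
      refine h n.lt_succ_self (SimplexCategory.σ i)
        ((coherentSimplex.obj ⦋k⦌).act (SimplexCategory.δ i.succ) f)
        (arrow_ext fun j ↦ ?_)
      rw [carr_act, carr_act]
      change carr f (i.succ.succAbove (i.predAbove j)) = _
      rcases eq_or_ne j i.succ with rfl | hj
      · rw [Fin.predAbove_succ_self, Fin.succAbove_succ_self, e]
      · rw [Fin.succ_succAbove_predAbove hj]
  · intro h m hm α hα x' y' g e
    obtain ⟨i, j, hij, e'⟩ : ∃ i j, i ≠ j ∧ α.toOrderHom i = α.toOrderHom j := by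
      have := Fintype.exists_ne_map_eq_of_card_lt (α := Fin (n + 1)) (β := Fin (m + 1))
        α.toOrderHom (by simpa using hm)
      simpa using this
    refine hij (h.injective ?_)
    rw [← carr_eq_of_arrow_eq e, ← carr_eq_of_arrow_eq e, carr_act, carr_act, e']

end Degenerate

/-! ### Flags -/

section Flag

variable {n k : ℕ}

lemma Flag.ext {S T : Flag n k} (h : ∀ i, S.T i = T.T i) : S = T := by
  obtain ⟨S, _, _, _⟩ := S
  obtain ⟨T, _, _, _⟩ := T
  obtain rfl : S = T := funext h
  rfl

lemma Flag.carr_zero (T : Flag n k) : carr T.arrow.{u} 0 = {0, Fin.last k} := by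
  rw [carr_arrow, Fin.rev_zero, T.last_eq]

lemma Flag.carr_last (T : Flag n k) : carr T.arrow.{u} (Fin.last n) = Set.univ := by
  rw [carr_arrow, Fin.rev_last, T.zero_eq]

lemma Flag.isProper_iff (T : Flag n k) : T.IsProper ↔ StrictMono (carr T.arrow.{u}) := by
  constructor
  · intro h i j hij
    rw [carr_arrow, carr_arrow]
    exact h (Fin.rev_lt_rev.2 hij)
  · intro h i j hij
    have := h (Fin.rev_lt_rev.2 hij)
    rwa [carr_arrow, carr_arrow, Fin.rev_rev, Fin.rev_rev] at this

/-- The flag corresponding to an increasing sequence of subsets from `{0, k}` to `[0, k]`. -/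
def Flag.ofMonotone (S : Fin (n + 1) → Set (Fin (k + 1))) (hS : Monotone S)
    (h0 : S 0 = {0, Fin.last k}) (h1 : S (Fin.last n) = Set.univ) : Flag n k where
  T i := S i.rev
  antitone _ _ h := hS (Fin.rev_le_rev.2 h)
  last_eq := by rw [Fin.rev_last, h0]
  zero_eq := by rw [Fin.rev_zero, h1]

lemma Flag.carr_ofMonotone (S : Fin (n + 1) → Set (Fin (k + 1))) (hS : Monotone S)
    (h0 : S 0 = {0, Fin.last k}) (h1 : S (Fin.last n) = Set.univ) (i : Fin (n + 1)) :
    carr (Flag.ofMonotone S hS h0 h1).arrow.{u} i = S i := by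
  rw [carr_arrow]
  exact congrArg S (Fin.rev_rev i)

/-- A flag can be degenerated. -/
lemma Flag.exists_act {m : ℕ} (T : Flag n k) (α : ⦋m⦌ ⟶ ⦋n⦌) [Epi α] :
    ∃ S : Flag m k,
      Arrow.mk S.arrow.{u} = Arrow.mk ((coherentSimplex.obj ⦋k⦌).act α T.arrow) := by
  refine ⟨Flag.ofMonotone (fun i ↦ carr T.arrow.{u} (α.toOrderHom i))
    (fun i j h ↦ carr_monotone _ (α.toOrderHom.monotone h)) ?_ ?_, arrow_ext fun i ↦ ?_⟩
  · exact (congrArg _ (toOrderHom_zero α)).trans T.carr_zero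
  · exact (congrArg _ (toOrderHom_last α)).trans T.carr_last
  · exact Flag.carr_ofMonotone ..

/-- The image of a flag under a surjection. -/
def Flag.push {l : ℕ} (T : Flag n k) (ε : ⦋k⦌ ⟶ ⦋l⦌) [Epi ε] : Flag n l where
  T i := ε.toOrderHom '' T.T i
  antitone _ _ h := Set.image_mono (T.antitone h)
  last_eq := by
    rw [T.last_eq, Set.image_pair]
    exact congrArg₂ (fun a b : Fin (l + 1) ↦ ({a, b} : Set (Fin (l + 1))))
      (toOrderHom_zero ε) (toOrderHom_last ε)
  zero_eq := by
    rw [T.zero_eq]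
    exact Set.image_univ_of_surjective (toOrderHom_surjective ε)

lemma Flag.push_arrow {l : ℕ} (T : Flag n k) (ε : ⦋k⦌ ⟶ ⦋l⦌) [Epi ε] :
    Arrow.mk (T.push ε).arrow.{u} =
      Arrow.mk ((SCat.levelMap (coherentSimplex.map ε) n).map T.arrow) :=
  arrow_ext fun i ↦ by rw [carr_map, carr_arrow, carr_arrow]; rfl

lemma Flag.push_comp {l m : ℕ} (T : Flag n k) (ε : ⦋k⦌ ⟶ ⦋l⦌) [Epi ε] (η : ⦋l⦌ ⟶ ⦋m⦌) [Epi η]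
    (θ : ⦋k⦌ ⟶ ⦋m⦌) [Epi θ] (h : ε ≫ η = θ) : T.push θ = (T.push ε).push η := by
  subst h
  refine Flag.ext fun i ↦ ?_
  change (ε ≫ η).toOrderHom '' T.T i = η.toOrderHom '' (ε.toOrderHom '' T.T i)
  rw [Set.image_image]
  rfl

/-- The smallest subset has two elements because `0 < k`, and each proper inclusion adds at least
one. The largest has `k + 1`, whence `n + 2 ≤ k + 1`. -/
lemma Flag.IsProper.lt {T : Flag n k} (hT : T.IsProper) (hk : 0 < k) : n < k := by
  have h1 : ∀ i : ℕ, ∀ hi : i < n + 1, i + 2 ≤ (carr T.arrow.{0} ⟨i, hi⟩).ncard := by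
    intro i
    induction i with
    | zero =>
      intro hi
      rw [show (⟨0, hi⟩ : Fin (n + 1)) = 0 from rfl, T.carr_zero, Set.ncard_pair]
      exact (Fin.lt_def.2 hk : (0 : Fin (k + 1)) < Fin.last k).ne
    | succ i ih =>
      intro hi
      have := Set.ncard_lt_ncard ((T.isProper_iff.1 hT)
        (show (⟨i, by omega⟩ : Fin (n + 1)) < ⟨i + 1, hi⟩ from Fin.lt_def.2 i.lt_succ_self))
      have := ih (by omega)
      omega
  have := h1 n (by omega)
  rw [show (⟨n, by omega⟩ : Fin (n + 1)) = Fin.last n from rfl, T.carr_last] at this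
  simp [Set.ncard_univ] at this
  omega

end Flag

/-! ### Arrows not in the image of a face map -/

/-- An arrow comes from the face opposite `i` exactly when `i` is missing from its largest subset. A
missing vertex is necessarily an inner one. -/
lemma carr_last_eq_univ_iff {n k : ℕ} (f : coherentSimplex.vertex.{u} n (0 : Fin (k + 2)) ⟶
    coherentSimplex.vertex n (Fin.last (k + 1))) :
    carr f (Fin.last n) = Set.univ ↔ ∀ i : Fin (k + 2), Arrow.mk f ∉
      Set.range (SCat.levelMap (coherentSimplex.map (SimplexCategory.δ i)) n).mapArrow.obj := by
  constructor
  · rintro h i ⟨g, hg⟩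
    have h1 := carr_eq_of_arrow_eq (g := f) (f := (SCat.levelMap (coherentSimplex.map
      (SimplexCategory.δ i)) n).map g.hom) hg (Fin.last n)
    rw [carr_map, h] at h1
    obtain ⟨t, -, ht⟩ : i ∈ (SimplexCategory.δ i).toOrderHom '' carr g.hom (Fin.last n) :=
      h1 ▸ Set.mem_univ i
    exact Fin.succAbove_ne i t ht
  · intro h
    by_contra hne
    obtain ⟨i, hi⟩ := (Set.ne_univ_iff_exists_notMem _).1 hne
    have hm := carr_monotone f
    have hi0 : i ≠ 0 := fun e ↦ hi (by rw [e]; exact left_mem_carr f _)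
    have hi1 : i ≠ Fin.last (k + 1) := fun e ↦ hi (by rw [e]; exact right_mem_carr f _)
    -- For `k = 0` the simplex is an edge and has no inner vertex.
    obtain ⟨k, rfl⟩ : ∃ l, k = l + 1 := by
      refine Nat.exists_eq_succ_of_ne_zero ?_
      rintro rfl
      rcases Fin.exists_fin_two.1 ⟨i, rfl⟩ with h | h
      exacts [hi0 h, hi1 h]
    refine h i ⟨Arrow.mk (mkArrow (coherentSimplex.vertex n (0 : Fin (k + 2)))
      (coherentSimplex.vertex n (Fin.last (k + 1))) (fun j ↦ i.succAbove ⁻¹' carr f j)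
      (fun _ _ h ↦ Set.preimage_mono (hm h)) ?_ ?_
      fun t _ ↦ ⟨Fin.zero_le _, Fin.le_last _⟩), ?_⟩
    · rw [Set.mem_preimage, idx_vertex, Fin.succAbove_ne_zero_zero hi0]
      exact left_mem_carr f 0
    · rw [Set.mem_preimage, idx_vertex, Fin.succAbove_ne_last_last hi1]
      exact right_mem_carr f 0
    · refine arrow_ext (g := f) fun j ↦ ?_
      refine (carr_map _ _ _).trans ?_
      change i.succAbove '' (i.succAbove ⁻¹' carr f j) = _
      rw [Set.image_preimage_eq_iff, Fin.range_succAbove]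
      rintro t ht rfl
      exact hi (hm (Fin.le_last j) ht)

lemma coherent_atomic_nondegenerate_iff (n k : ℕ)
    (f : coherentSimplex.vertex.{u} n (0 : Fin (k + 2)) ⟶
      coherentSimplex.vertex n (Fin.last (k + 1))) :
    (IsAtomic f ∧ Arrow.mk f ∈ (coherentSimplex.obj ⦋k + 1⦌).nonDegenerateArrows n ∧
      ∀ i : Fin (k + 2), Arrow.mk f ∉
        Set.range (SCat.levelMap (coherentSimplex.map (SimplexCategory.δ i)) n).mapArrow.obj) ↔
      ∃ T : Flag n (k + 1), T.IsProper ∧ T.arrow = f := by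
  rw [coherent_mem_nonDegenerate_iff, ← carr_last_eq_univ_iff, coherent_isAtomic_iff]
  constructor
  · rintro ⟨⟨-, h0⟩, hs, h1⟩
    have e : (Flag.ofMonotone (carr f) (carr_monotone f) h0 h1).arrow = f :=
      carr_ext fun i ↦ Flag.carr_ofMonotone _ _ _ _ _
    exact ⟨_, (Flag.isProper_iff _).2 (by rwa [e]), e⟩
  · rintro ⟨T, hT, rfl⟩
    exact ⟨⟨Fin.lt_def.2 k.succ_pos, T.carr_zero⟩, (Flag.isProper_iff T).1 hT, T.carr_last⟩

/-! ### The realization as a levelwise colimit -/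

section Colimit

open Limits

/-- The functor sending a simplicial category to its category of `n`-arrows. -/
def levelFunctor (n : ℕ) : SCat.{u} ⥤ Cat.{u, u} :=
  IsSimplicialCat.ι ⋙ (evaluation _ _).obj (op ⦋n⦌)

/-- Simplicial categories are closed under colimits among simplicial objects in `Cat`, where
colimits are computed pointwise. -/
instance (n : ℕ) : PreservesColimitsOfSize.{0, u} (levelFunctor.{u} n) :=
  have : PreservesColimitsOfSize.{u, u} IsSimplicialCat.{u}.ι := ⟨inferInstance⟩
  have : PreservesColimitsOfSize.{u, u} (levelFunctor.{u} n) :=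
    comp_preservesColimits _ _
  preservesColimitsOfSize_of_univLE.{u, u, 0, u} _

variable (X : SSet.{u})

/-- `ℭX` is the colimit of the homotopy coherent simplices. -/
def isColimitRealization : IsColimit ((Functor.LeftExtension.mk _
    (yonedaEmbedding.{u}.leftKanExtensionUnit coherentSimplex.{u})).coconeAt X) :=
  Functor.isPointwiseLeftKanExtensionOfIsLeftKanExtension
    (yonedaEmbedding.{u}.leftKanExtension coherentSimplex.{u})
    (yonedaEmbedding.{u}.leftKanExtensionUnit coherentSimplex.{u}) X

def isColimitLevel (n : ℕ) := isColimitOfPreserves (levelFunctor.{u} n) (isColimitRealization X)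

variable {X}

lemma simplexMap_eq {k : ℕ} (s : yonedaEmbedding.{u}.obj ⦋k⦌ ⟶ X) :
    (yonedaEmbedding.{u}.leftKanExtensionUnit coherentSimplex.{u}).app ⦋k⦌ ≫ realization.map s =
      simplexMap (SSet.yonedaEquiv s) := by
  rw [simplexMap]
  exact congrArg (fun t ↦ _ ≫ realization.map t) (SSet.yonedaEquiv.symm_apply_apply s).symm

lemma simplexMap_map {k l : ℕ} (θ : ⦋k⦌ ⟶ ⦋l⦌) (σ : X _⦋l⦌) :
    simplexMap (X.map θ.op σ) = coherentSimplex.map θ ≫ simplexMap σ := by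
  have h : SSet.yonedaEquiv.symm (X.map θ.op σ) =
      SSet.stdSimplex.map θ ≫ SSet.yonedaEquiv.symm σ :=
    (SSet.yonedaEquiv_symm_naturality_left _ _).symm
  have h2 := (yonedaEmbedding.{u}.leftKanExtensionUnit coherentSimplex.{u}).naturality θ
  rw [simplexMap, simplexMap, h]
  refine (congrArg _ (realization.map_comp _ _)).trans ?_
  refine ((Category.assoc _ _ _).symm.trans ?_).trans (Category.assoc _ _ _)
  exact congrArg (· ≫ realization.map (SSet.yonedaEquiv.symm σ)) h2.symm

lemma level_hom_ext {n : ℕ} {D : Cat.{u, u}} {F G : (realization.obj X).level n ⥤ D}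
    (h : ∀ (k : ℕ) (σ : X _⦋k⦌), SCat.levelMap (simplexMap σ) n ⋙ F =
      SCat.levelMap (simplexMap σ) n ⋙ G) : F = G := by
  suffices F.toCatHom = G.toCatHom from congrArg Cat.Hom.toFunctor this
  refine (isColimitLevel X n).hom_ext fun j ↦ ?_
  obtain ⟨⟨k⟩, _, s⟩ := j
  have := congrArg Functor.toCatHom (h k (SSet.yonedaEquiv s))
  rw [← simplexMap_eq] at this
  exact this

/-- The universal property of the colimit, in terms of simplices of `X` instead of objects of the
comma category. A morphism there is an operator `θ` with one simplex the restriction of the other.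
-/
lemma exists_level_desc {n : ℕ} {D : Cat.{u, u}}
    (F : ∀ (k : ℕ) (_ : X _⦋k⦌), (coherentSimplex.{u}.obj ⦋k⦌).level n ⥤ D)
    (hF : ∀ (k l : ℕ) (θ : ⦋k⦌ ⟶ ⦋l⦌) (σ : X _⦋l⦌),
      SCat.levelMap (coherentSimplex.map θ) n ⋙ F l σ = F k (X.map θ.op σ)) :
    ∃ G : (realization.obj X).level n ⥤ D,
      ∀ (k : ℕ) (σ : X _⦋k⦌), SCat.levelMap (simplexMap σ) n ⋙ G = F k σ := by
  let c : Cocone ((CostructuredArrow.proj yonedaEmbedding.{u} X ⋙ coherentSimplex.{u}) ⋙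
      levelFunctor.{u} n) :=
    { pt := D
      ι :=
        { app j := (F j.left.len (SSet.yonedaEquiv j.hom)).toCatHom
          naturality i j φ := by
            obtain ⟨⟨k⟩, _, s⟩ := i
            obtain ⟨⟨l⟩, _, t⟩ := j
            have h := congrArg Functor.toCatHom (hF k l φ.left (SSet.yonedaEquiv t))
            have h2 : X.map φ.left.op (SSet.yonedaEquiv t) = SSet.yonedaEquiv s :=
              (SSet.yonedaEquiv_naturality _ _).trans
                (congrArg SSet.yonedaEquiv (CostructuredArrow.w φ))
            rw [h2] at h
            exact h } }
  refine ⟨((isColimitLevel X n).desc c).toFunctor, fun k σ ↦ ?_⟩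
  have := (isColimitLevel X n).fac c (CostructuredArrow.mk (S := yonedaEmbedding.{u}) (Y := ⦋k⦌)
    (SSet.yonedaEquiv.symm σ))
  have := congrArg Cat.Hom.toFunctor this
  refine Eq.trans this ?_
  change F k _ = F k _
  congr 1
  exact SSet.yonedaEquiv.apply_symm_apply σ

end Colimit

/-! ### Beads representing arrows of the homotopy coherent simplices -/

section Represents

variable {X : SSet.{u}} {n : ℕ}

lemma simplexVertex_map {k l : ℕ} (θ : ⦋k⦌ ⟶ ⦋l⦌) (σ : X _⦋l⦌) (i : Fin (k + 1)) :
    simplexVertex (X.map θ.op σ) i = simplexVertex σ (θ.toOrderHom i) := by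
  have h : SimplexCategory.const ⦋0⦌ ⦋k⦌ i ≫ θ =
      SimplexCategory.const ⦋0⦌ ⦋l⦌ (θ.toOrderHom i) := rfl
  rw [simplexVertex, simplexVertex, ← h, op_comp, X.map_comp]
  rfl

lemma simplexVertex_zero (x : X _⦋0⦌) : simplexVertex x 0 = x := by
  have h : SimplexCategory.const ⦋0⦌ ⦋0⦌ 0 = 𝟙 _ :=
    (SimplexCategory.eq_const_to_zero (𝟙 _)).symm
  rw [simplexVertex, h, op_id, X.map_id]
  rfl

lemma arrow_mk_simplexMap_map {k l : ℕ} (θ : ⦋k⦌ ⟶ ⦋l⦌) (σ : X _⦋l⦌)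
    {x y : (coherentSimplex.{u}.obj ⦋k⦌).level n} (f : x ⟶ y) :
    Arrow.mk ((SCat.levelMap (simplexMap (X.map θ.op σ)) n).map f) =
      Arrow.mk ((SCat.levelMap (simplexMap σ) n).map
        ((SCat.levelMap (coherentSimplex.map θ) n).map f)) := by
  rw [simplexMap_map]
  rfl

lemma levelMap_simplexMap_obj {k : ℕ} (σ : X _⦋k⦌)
    (x : (coherentSimplex.{u}.obj ⦋k⦌).level n) :
    (SCat.levelMap (simplexMap σ) n).obj x = vertexObj n (simplexVertex σ (idx x)) := by
  rw [vertexObj, simplexVertex, simplexMap_map]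
  rfl

/-- A bead with non-degenerate simplex represents an `n`-arrow `f` of `ℭ[k]` with respect to
a `k`-simplex `σ` if `f` is the image of a flag on a simplex of `Δ[k]` whose image in `X`
degenerates the simplex of the bead. -/
def Represents {k : ℕ} (σ : X _⦋k⦌) {x y : (coherentSimplex.{u}.obj ⦋k⦌).level n} (f : x ⟶ y)
    (b : Bead X n) : Prop :=
  b.simplex ∈ X.nonDegenerate b.dim ∧
  ∃ (m : ℕ) (μ : ⦋m⦌ ⟶ ⦋k⦌) (F : Flag n m) (ε : ⦋m⦌ ⟶ ⦋b.dim⦌) (_ : Epi ε),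
    Arrow.mk ((SCat.levelMap (coherentSimplex.map μ) n).map F.arrow) = Arrow.mk f ∧
    X.map μ.op σ = X.map ε.op b.simplex ∧ b.flag = F.push ε

variable {k : ℕ} {x y : (coherentSimplex.{u}.obj ⦋k⦌).level n}

/-- An arrow with only endpoints in its initial vertex is the image of a flag on a face. -/
lemma exists_flag (f : x ⟶ y) (hf : carr f 0 = {idx x, idx y}) :
    ∃ (m : ℕ) (μ : ⦋m⦌ ⟶ ⦋k⦌) (F : Flag n m), Function.Injective μ.toOrderHom ∧
      Arrow.mk ((SCat.levelMap (coherentSimplex.map μ) n).map F.arrow) = Arrow.mk f := by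
  classical
  have hm := carr_monotone f
  let s : Finset (Fin (k + 1)) := (carr f (Fin.last n)).toFinset
  obtain ⟨m, hsm⟩ : ∃ m, s.card = m + 1 := by
    refine Nat.exists_eq_succ_of_ne_zero (Finset.card_ne_zero_of_mem (a := idx x) ?_)
    rw [Set.mem_toFinset]
    exact left_mem_carr f _
  -- The face is spanned by the largest subset of `f`, so that the pulled back chain ends in the
  -- whole of `[m]`.
  let μ := s.orderEmbOfFin hsm
  have hr : Set.range μ = carr f (Fin.last n) := by
    rw [Finset.range_orderEmbOfFin, Set.coe_toFinset]
  have hx : μ 0 = idx x := by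
    obtain ⟨a, ha⟩ : idx x ∈ Set.range μ := hr ▸ left_mem_carr f _
    exact le_antisymm (ha ▸ μ.monotone (Fin.zero_le a))
      (left_le_of_mem_carr f (i := Fin.last n) (hr ▸ Set.mem_range_self 0))
  have hy : μ (Fin.last m) = idx y := by
    obtain ⟨a, ha⟩ : idx y ∈ Set.range μ := hr ▸ right_mem_carr f _
    exact le_antisymm (le_right_of_mem_carr f (i := Fin.last n) (hr ▸ Set.mem_range_self _))
      (ha ▸ μ.monotone (Fin.le_last a))
  let F : Flag n m := Flag.ofMonotone (fun i ↦ μ ⁻¹' carr f i)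
    (fun i j h ↦ Set.preimage_mono (hm h))
    (by
      rw [hf, ← hx, ← hy, ← Set.image_pair, μ.injective.preimage_image])
    (by rw [← hr, Set.preimage_range])
  refine ⟨m, SimplexCategory.Hom.mk μ.toOrderHom, F, μ.injective, arrow_ext fun i ↦ ?_⟩
  have hi : carr F.arrow.{u} i = μ ⁻¹' carr f i := Flag.carr_ofMonotone ..
  rw [carr_map, hi]
  change μ '' (μ ⁻¹' carr f i) = carr f i
  rw [Set.image_preimage_eq_iff, hr]
  exact hm (Fin.le_last i)

/-- Comparison of two presentations of an arrow by flags. -/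
lemma exists_comparison {f : x ⟶ y} {m m' : ℕ} {μ : ⦋m⦌ ⟶ ⦋k⦌} {F : Flag n m}
    (hμ : Function.Injective μ.toOrderHom)
    (hF : Arrow.mk ((SCat.levelMap (coherentSimplex.map μ) n).map F.arrow) = Arrow.mk f)
    {μ' : ⦋m'⦌ ⟶ ⦋k⦌} {F' : Flag n m'}
    (hF' : Arrow.mk ((SCat.levelMap (coherentSimplex.map μ') n).map F'.arrow) = Arrow.mk f) :
    ∃ (κ : ⦋m'⦌ ⟶ ⦋m⦌) (_ : Epi κ), κ ≫ μ = μ' ∧ F = F'.push κ := by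
  have h (i : Fin (n + 1)) : μ.toOrderHom '' carr F.arrow.{u} i =
      μ'.toOrderHom '' carr F'.arrow.{u} i := by
    rw [← carr_map, ← carr_map]
    exact carr_eq_of_arrow_eq (hF.trans hF'.symm) i
  have hr : Set.range μ.toOrderHom = Set.range μ'.toOrderHom := by
    have := h (Fin.last n)
    rwa [Flag.carr_last, Flag.carr_last, Set.image_univ, Set.image_univ] at this
  -- The maps `μ` and `μ'` both have the largest subset of `f` as image. As `μ` is injective, `μ'`
  -- factors through it, by a surjection.
  have h1 (i : Fin (m' + 1)) : ∃ j : Fin (m + 1), μ.toOrderHom j = μ'.toOrderHom i := by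
    have : μ'.toOrderHom i ∈ Set.range μ'.toOrderHom := Set.mem_range_self i
    rwa [← hr] at this
  choose κ hκ using h1
  have hmono : StrictMono μ.toOrderHom := μ.toOrderHom.monotone.strictMono_of_injective hμ
  let κ' : ⦋m'⦌ ⟶ ⦋m⦌ := SimplexCategory.Hom.mk
    ⟨κ, fun i j hij ↦ hmono.le_iff_le.1 (by
      rw [hκ, hκ]
      exact μ'.toOrderHom.monotone hij)⟩
  have hc : κ' ≫ μ = μ' := by
    ext i : 3
    exact hκ i
  have hepi : Epi κ' := SimplexCategory.epi_iff_surjective.2 fun j ↦ by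
    obtain ⟨i, hi⟩ : μ.toOrderHom j ∈ Set.range μ'.toOrderHom := hr ▸ Set.mem_range_self j
    exact ⟨i, hμ ((hκ i).trans hi)⟩
  refine ⟨κ', hepi, hc, Flag.ext fun i ↦ hμ.image_injective ?_⟩
  have := h i.rev
  rw [carr_arrow, carr_arrow, Fin.rev_rev] at this
  refine this.trans ?_
  change _ = μ.toOrderHom '' (κ '' F'.T i)
  rw [Set.image_image]
  exact Set.image_congr fun t _ ↦ (hκ t).symm

/-- The normal form: restrict to the face spanned by `f`, then collapse onto the non-degenerate
simplex that it degenerates. -/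
lemma exists_represents (σ : X _⦋k⦌) (f : x ⟶ y) (hf : carr f 0 = {idx x, idx y}) :
    ∃ b, Represents σ f b := by
  obtain ⟨m, μ, F, -, hF⟩ := exists_flag f hf
  obtain ⟨d, ε, hε, τ, e⟩ := X.exists_nonDegenerate (X.map μ.op σ)
  exact ⟨⟨d, τ.1, F.push ε⟩, τ.2, m, μ, F, ε, hε, hF, e, rfl⟩

lemma Represents.carr_zero {σ : X _⦋k⦌} {f : x ⟶ y} {b : Bead X n} (h : Represents σ f b) :
    carr f 0 = {idx x, idx y} := by
  obtain ⟨-, m, μ, F, ε, -, hF, -, -⟩ := h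
  have hx : μ.toOrderHom 0 = idx x := congrArg (fun a : Arrow _ ↦ idx a.left) hF
  have hy : μ.toOrderHom (Fin.last m) = idx y := congrArg (fun a : Arrow _ ↦ idx a.right) hF
  rw [← carr_eq_of_arrow_eq hF, carr_map, Flag.carr_zero, ← hx, ← hy]
  exact Set.image_pair _ _ _

lemma Represents.unique {σ : X _⦋k⦌} {f : x ⟶ y} {b b' : Bead X n} (h : Represents σ f b)
    (h' : Represents σ f b') : b = b' := by
  obtain ⟨m, μ, F, hμ, hF⟩ := exists_flag f h.carr_zero
  obtain ⟨d, ε, hε, τ, e⟩ := X.exists_nonDegenerate (X.map μ.op σ)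
  -- Every representing bead is compared with one fixed normal form, built from an injective `μ`.
  suffices ∀ b, Represents σ f b → b = ⟨d, τ.1, F.push ε⟩ from (this b h).trans (this b' h').symm
  rintro ⟨d', τ', G⟩ ⟨hτ', m', μ', F', ε', hε', hF', e', hG⟩
  obtain ⟨κ, hκ, rfl, rfl⟩ := exists_comparison hμ hF hF'
  -- The same simplex is now written in two ways as a degeneracy of a non-degenerate one;
  -- Eilenberg-Zilber uniqueness identifies the dimensions, simplices and operators.
  have e2 : X.map (κ ≫ μ).op σ = X.map (κ ≫ ε).op τ.1 := by
    rw [op_comp, op_comp, X.map_comp, X.map_comp]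
    exact congrArg _ e
  have e3 : X.map (κ ≫ μ).op σ = X.map ε'.op τ' := e'
  obtain rfl : d = d' := X.unique_nonDegenerate_dim _ (κ ≫ ε) τ e2 ε' ⟨τ', hτ'⟩ e3
  obtain rfl : τ = ⟨τ', hτ'⟩ := X.unique_nonDegenerate_simplex _ (κ ≫ ε) τ e2 ε' ⟨τ', hτ'⟩ e3
  have e4 : κ ≫ ε = ε' := X.unique_nonDegenerate_map _ (κ ≫ ε) ⟨τ', hτ'⟩ e2 ε' ⟨τ', hτ'⟩ e3
  have e5 : G = F'.push ε' := hG
  rw [e5, Flag.push_comp F' κ ε ε' e4]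

/-- This holds because `μ` is not required to be injective in `Represents`: it can simply be
composed with `θ`. It is what makes the functors to bead paths a cocone. -/
lemma Represents.map {l : ℕ} {θ : ⦋k⦌ ⟶ ⦋l⦌} {σ : X _⦋l⦌} {f : x ⟶ y} {b : Bead X n}
    (h : Represents (X.map θ.op σ) f b) :
    Represents σ ((SCat.levelMap (coherentSimplex.map θ) n).map f) b := by
  obtain ⟨hb, m, μ, F, ε, hε, hF, e, hG⟩ := h
  refine ⟨hb, m, μ ≫ θ, F, ε, hε, ?_, ?_, hG⟩
  · rw [coherentSimplex.map_comp]
    exact arrow_map_congr (SCat.levelMap (coherentSimplex.map θ) n) hF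
  · rw [op_comp, X.map_comp]
    exact e

lemma represents_flag_arrow (b : Bead X n) (hb : b.simplex ∈ X.nonDegenerate b.dim) :
    Represents b.simplex b.flag.arrow.{u} b := by
  refine ⟨hb, b.dim, 𝟙 _, b.flag, 𝟙 _, inferInstance, ?_, rfl, Flag.ext fun i ↦ ?_⟩
  · rw [coherentSimplex.map_id]
    rfl
  · exact (Set.image_id _).symm

/-- In `ℭX` the flag `F` can be moved along `ε` to the simplex of the bead, and along `μ` to `σ`. -/
lemma Represents.arrow_eq {σ : X _⦋k⦌} {f : x ⟶ y} {b : Bead X n} (h : Represents σ f b) :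
    b.arrow = Arrow.mk ((SCat.levelMap (simplexMap σ) n).map f) := by
  obtain ⟨hb, m, μ, F, ε, hε, hF, e, hG⟩ := h
  rw [Bead.arrow, simplexArrow, hG]
  calc
    _ = Arrow.mk ((SCat.levelMap (simplexMap b.simplex) n).map
          ((SCat.levelMap (coherentSimplex.map ε) n).map F.arrow)) :=
        arrow_map_congr _ (F.push_arrow ε)
    _ = Arrow.mk ((SCat.levelMap (simplexMap (X.map ε.op b.simplex)) n).map F.arrow) :=
        (arrow_mk_simplexMap_map ε _ _).symm
    _ = Arrow.mk ((SCat.levelMap (simplexMap (X.map μ.op σ)) n).map F.arrow) := by rw [e]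
    _ = Arrow.mk ((SCat.levelMap (simplexMap σ) n).map
          ((SCat.levelMap (coherentSimplex.map μ) n).map F.arrow)) :=
        arrow_mk_simplexMap_map μ _ _
    _ = _ := arrow_map_congr _ hF

/-- The initial vertex of the simplex of a bead. -/
def Bead.source (b : Bead X n) : X _⦋0⦌ := simplexVertex b.simplex 0

/-- The final vertex of the simplex of a bead. -/
def Bead.target (b : Bead X n) : X _⦋0⦌ := simplexVertex b.simplex (Fin.last _)

lemma Represents.source_eq {σ : X _⦋k⦌} {f : x ⟶ y} {b : Bead X n} (h : Represents σ f b) :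
    b.source = simplexVertex σ (idx x) := by
  obtain ⟨-, m, μ, F, ε, hε, hF, e, -⟩ := h
  have hx : μ.toOrderHom 0 = idx x := congrArg (fun a : Arrow _ ↦ idx a.left) hF
  have := congrArg (fun s ↦ simplexVertex s (0 : Fin (m + 1))) e
  dsimp only at this
  rw [simplexVertex_map, simplexVertex_map, toOrderHom_zero ε, hx] at this
  exact this.symm

lemma Represents.target_eq {σ : X _⦋k⦌} {f : x ⟶ y} {b : Bead X n} (h : Represents σ f b) :
    b.target = simplexVertex σ (idx y) := by
  obtain ⟨-, m, μ, F, ε, hε, hF, e, -⟩ := h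
  have hy : μ.toOrderHom (Fin.last m) = idx y := congrArg (fun a : Arrow _ ↦ idx a.right) hF
  have := congrArg (fun s ↦ simplexVertex s (Fin.last m)) e
  dsimp only at this
  rw [simplexVertex_map, simplexVertex_map, toOrderHom_last ε, hy] at this
  exact this.symm

/-- The only flag on the `0`-simplex. -/
def Flag.ofVertex (n : ℕ) : Flag n 0 where
  T _ := Set.univ
  antitone _ _ _ := le_rfl
  last_eq := by
    ext i
    fin_cases i
    simp
  zero_eq := rfl

/-- An operator may collapse an atomic arrow to an identity. Zero-dimensional beads let both cases
be treated alike. -/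
lemma represents_of_isIdentity (σ : X _⦋k⦌) (f : x ⟶ y) (hf : IsIdentity f) :
    Represents σ f ⟨0, simplexVertex σ (idx x), Flag.ofVertex n⟩ := by
  obtain ⟨⟩ := hf
  refine ⟨?_, 0, SimplexCategory.const ⦋0⦌ ⦋k⦌ (idx x), Flag.ofVertex n, 𝟙 _, inferInstance,
    arrow_ext fun i ↦ ?_, ?_, Flag.ext fun i ↦ ?_⟩
  · rw [X.nondegenerate_zero]
    exact Set.mem_univ _
  · rw [carr_map, carr_id, carr_arrow]
    exact (Set.image_univ).trans Set.range_const
  · rw [op_id, X.map_id]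
    rfl
  · exact (Set.image_id _).symm

end Represents

/-! ### The category of paths of beads -/

section BeadPaths

/-- The vertices of `X`, as the vertices of the directed graph of non-degenerate beads. -/
structure BeadGraph (X : SSet.{u}) (n : ℕ) : Type u where
  as : X _⦋0⦌

instance (X : SSet.{u}) (n : ℕ) : Quiver.{u} (BeadGraph X n) where
  Hom x y := {b : Bead X n //
    0 < b.dim ∧ b.simplex ∈ X.nonDegenerate b.dim ∧ b.source = x.as ∧ b.target = y.as}

/-- The category of paths of non-degenerate beads. -/
def BeadCat (X : SSet.{u}) (n : ℕ) : Type u := Paths (BeadGraph X n)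

instance (X : SSet.{u}) (n : ℕ) : Category.{u} (BeadCat X n) :=
  inferInstanceAs (Category (Paths (BeadGraph X n)))

variable {X : SSet.{u}} {n : ℕ}

/-- A vertex of `X` as an object of the category of paths of beads. -/
def BeadCat.vertex (x : X _⦋0⦌) : BeadCat X n := BeadGraph.mk (n := n) x

lemma Bead.source_eq_target (b : Bead X n) (h : ¬ 0 < b.dim) : b.source = b.target := by
  obtain ⟨d, σ, F⟩ := b
  obtain rfl : d = 0 := by simpa using h
  rfl

/-- The path of length one given by a bead of positive dimension. -/
def Bead.edge (b : Bead X n) (h : 0 < b.dim) (hb : b.simplex ∈ X.nonDegenerate b.dim)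
    {x y : X _⦋0⦌} (hx : b.source = x) (hy : b.target = y) :
    BeadCat.vertex (n := n) x ⟶ BeadCat.vertex y :=
  Quiver.Hom.toPath (V := BeadGraph X n) (a := ⟨x⟩) (b := ⟨y⟩) ⟨b, h, hb, hx, hy⟩

/-- The path given by a bead: it has length one unless the bead is zero-dimensional. -/
def Bead.path (b : Bead X n) (hb : b.simplex ∈ X.nonDegenerate b.dim) {x y : X _⦋0⦌}
    (hx : b.source = x) (hy : b.target = y) :
    BeadCat.vertex (n := n) x ⟶ BeadCat.vertex y :=
  if h : 0 < b.dim then b.edge h hb hx hy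
  else eqToHom (by rw [← hx, ← hy, b.source_eq_target h])

lemma arrow_eq_id_of_isIdentity {C : Type*} [Category C] {x y : C} {f : x ⟶ y}
    (h : IsIdentity f) : Arrow.mk f = Arrow.mk (𝟙 x) := by
  cases h
  rfl

lemma isIdentity_eqToHom {C : Type*} [Category C] {x y : C} (h : x = y) :
    IsIdentity (eqToHom h) := by
  subst h
  exact .id _

lemma Bead.path_of_pos (b : Bead X n) (h : 0 < b.dim) (hb : b.simplex ∈ X.nonDegenerate b.dim)
    {x y : X _⦋0⦌} (hx : b.source = x) (hy : b.target = y) : b.path hb hx hy = b.edge h hb hx hy :=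
  dif_pos h

lemma Bead.isIdentity_path (b : Bead X n) (h : ¬ 0 < b.dim)
    (hb : b.simplex ∈ X.nonDegenerate b.dim) {x y : X _⦋0⦌} (hx : b.source = x)
    (hy : b.target = y) : IsIdentity (b.path hb hx hy) := by
  rw [show b.path hb hx hy = _ from dif_neg h]
  exact isIdentity_eqToHom _

lemma Bead.arrow_mk_path_eq {b b' : Bead X n} (e : b = b')
    (hb : b.simplex ∈ X.nonDegenerate b.dim) {x y : X _⦋0⦌}
    (hx : b.source = x) (hy : b.target = y) (hb' : b'.simplex ∈ X.nonDegenerate b'.dim)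
    {x' y' : X _⦋0⦌} (hx' : b'.source = x') (hy' : b'.target = y') :
    Arrow.mk (b.path hb hx hy) = Arrow.mk (b'.path hb' hx' hy') := by
  subst e hx hy hx' hy'
  rfl

/-- The functor from `ℭ[k]` to the category of paths of beads given by a `k`-simplex of `X`. -/
def beadFunctor (n : ℕ) {k : ℕ} (σ : X _⦋k⦌) :
    (coherentSimplex.{u}.obj ⦋k⦌).level n ⥤ BeadCat X n :=
  (coherent_freeCriterion n k).lift
    { obj x := BeadCat.vertex (simplexVertex σ (idx x.as))
      map f :=
        have h := exists_represents σ f.1 ((coherent_isAtomic_iff f.1).1 f.2).2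
        h.choose.path h.choose_spec.1 h.choose_spec.source_eq h.choose_spec.target_eq }

lemma beadFunctor_obj {k : ℕ} (σ : X _⦋k⦌) (x : (coherentSimplex.{u}.obj ⦋k⦌).level n) :
    (beadFunctor n σ).obj x = BeadCat.vertex (simplexVertex σ (idx x)) := rfl

/-- Uniqueness of beads makes `beadFunctor` independent of the choices in its definition. A
represented arrow that is not atomic is an identity, and its bead is zero-dimensional. -/
lemma Represents.arrow_mk_beadFunctor_map {k : ℕ} {σ : X _⦋k⦌}
    {x y : (coherentSimplex.{u}.obj ⦋k⦌).level n} {f : x ⟶ y} {b : Bead X n}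
    (h : Represents σ f b) :
    Arrow.mk ((beadFunctor n σ).map f) = Arrow.mk (b.path h.1 rfl rfl) := by
  by_cases hf : IsAtomic f
  · rw [beadFunctor, FreeCriterion.lift_map_of_isAtomic _ _ f hf]
    have h' := exists_represents σ f ((coherent_isAtomic_iff f).1 hf).2
    exact Bead.arrow_mk_path_eq (h'.choose_spec.unique h) h'.choose_spec.1
      h'.choose_spec.source_eq h'.choose_spec.target_eq h.1 rfl rfl
  · have hi : IsIdentity f := by
      rw [coherent_isIdentity_iff]
      rw [coherent_isAtomic_iff, not_and] at hf
      by_contra hne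
      exact hf ((idx_le f).lt_of_ne hne) h.carr_zero
    have hs := h.source_eq
    obtain rfl := h.unique (represents_of_isIdentity σ f hi)
    rw [arrow_eq_id_of_isIdentity (hi.map _),
      arrow_eq_id_of_isIdentity (Bead.isIdentity_path _ (Nat.lt_irrefl 0) _ _ _),
      beadFunctor_obj, hs]

lemma beadFunctor_map {k l : ℕ} (θ : ⦋k⦌ ⟶ ⦋l⦌) (σ : X _⦋l⦌) :
    SCat.levelMap (coherentSimplex.map θ) n ⋙ beadFunctor n σ =
      beadFunctor n (X.map θ.op σ) := by
  refine (coherent_freeCriterion n k).functor_ext (fun x ↦ ?_) fun x y f hf ↦ ?_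
  · rw [beadFunctor_obj, simplexVertex_map]
    rfl
  · obtain ⟨b, hb⟩ := exists_represents (X.map θ.op σ) f ((coherent_isAtomic_iff f).1 hf).2
    exact hb.map.arrow_mk_beadFunctor_map.trans hb.arrow_mk_beadFunctor_map.symm

variable (X n) in
/-- The functor from the `n`-arrows of `ℭX` to the paths of beads. -/
def toBeads : (realization.obj X).level n ⥤ BeadCat X n :=
  (exists_level_desc (D := Cat.of (BeadCat X n)) (fun _ σ ↦ beadFunctor n σ) fun _ _ ↦ beadFunctor_map).choose

lemma levelMap_comp_toBeads {k : ℕ} (σ : X _⦋k⦌) :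
    SCat.levelMap (simplexMap σ) n ⋙ toBeads X n = beadFunctor n σ :=
  (exists_level_desc (D := Cat.of (BeadCat X n)) (fun _ σ ↦ beadFunctor n σ) fun _ _ ↦ beadFunctor_map).choose_spec k σ

lemma arrow_mk_toBeads_map {k : ℕ} (σ : X _⦋k⦌)
    {x y : (coherentSimplex.{u}.obj ⦋k⦌).level n} (f : x ⟶ y) :
    Arrow.mk ((toBeads X n).map ((SCat.levelMap (simplexMap σ) n).map f)) =
      Arrow.mk ((beadFunctor n σ).map f) :=
  Functor.congr_obj (congrArg Functor.mapArrow (levelMap_comp_toBeads σ)) (Arrow.mk f)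

lemma toBeads_obj (x : X _⦋0⦌) : (toBeads X n).obj (vertexObj n x) = BeadCat.vertex x := by
  refine (Functor.congr_obj (levelMap_comp_toBeads (n := n) x) _).trans ?_
  rw [beadFunctor_obj, idx_vertex, simplexVertex_zero]

lemma simplexArrow_left {k : ℕ} (σ : X _⦋k⦌) (T : Flag n k) :
    (simplexArrow σ T).left = vertexObj n (simplexVertex σ 0) :=
  levelMap_simplexMap_obj σ _

lemma simplexArrow_right {k : ℕ} (σ : X _⦋k⦌) (T : Flag n k) :
    (simplexArrow σ T).right = vertexObj n (simplexVertex σ (Fin.last k)) :=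
  levelMap_simplexMap_obj σ _

variable (X n) in
/-- The functor from the paths of beads to the `n`-arrows of `ℭX`. -/
def ofBeads : BeadCat X n ⥤ (realization.obj X).level n :=
  Paths.lift (V := BeadGraph X n)
    { obj x := vertexObj n x.as
      map {x y} b := eqToHom (by
          exact (congrArg (vertexObj n) b.2.2.2.1.symm).trans
            (simplexArrow_left b.1.simplex b.1.flag).symm) ≫
        b.1.arrow.hom ≫ eqToHom (by
          exact (simplexArrow_right b.1.simplex b.1.flag).trans
            (congrArg (vertexObj n) b.2.2.2.2)) }

lemma ofBeads_obj (x : X _⦋0⦌) : (ofBeads X n).obj (BeadCat.vertex x) = vertexObj n x := rfl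

lemma arrow_mk_ofBeads_map (b : Bead X n) (hb : b.simplex ∈ X.nonDegenerate b.dim)
    {x y : X _⦋0⦌} (hx : b.source = x) (hy : b.target = y) :
    Arrow.mk ((ofBeads X n).map (b.path hb hx hy)) = b.arrow := by
  by_cases h : 0 < b.dim
  · rw [b.path_of_pos h]
    refine (congrArg Arrow.mk (Paths.lift_toPath _ _)).trans ?_
    exact arrow_mk_eqToHom_comp _ _ _
  · rw [arrow_eq_id_of_isIdentity ((b.isIdentity_path h hb hx hy).map (ofBeads X n)),
      ofBeads_obj, ← hx]
    have h1 : IsIdentity b.flag.arrow.{u} := by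
      rw [coherent_isIdentity_iff, idx_vertex, idx_vertex, Fin.ext_iff, Fin.val_last, Fin.val_zero]
      omega
    refine Eq.trans ?_ (arrow_eq_id_of_isIdentity
      (h1.map (SCat.levelMap (simplexMap b.simplex) n))).symm
    rw [levelMap_simplexMap_obj]
    rfl

/-- It suffices to check atomic arrows of each `ℭ[k]`, and such an arrow has the same image in `ℭX`
as the bead representing it. -/
lemma toBeads_comp_ofBeads : toBeads X n ⋙ ofBeads X n = 𝟭 _ := by
  refine level_hom_ext (D := (realization.obj X).level n) fun k σ ↦ ?_
  refine (coherent_freeCriterion n k).functor_ext (fun x ↦ ?_) fun x y f hf ↦ ?_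
  · refine (congrArg (ofBeads X n).obj
      (Functor.congr_obj (levelMap_comp_toBeads (n := n) σ) x)).trans ?_
    exact (levelMap_simplexMap_obj σ x).symm
  · obtain ⟨b, hb⟩ := exists_represents σ f ((coherent_isAtomic_iff f).1 hf).2
    exact (arrow_map_congr (ofBeads X n) ((arrow_mk_toBeads_map σ f).trans
      hb.arrow_mk_beadFunctor_map)).trans ((arrow_mk_ofBeads_map b hb.1 rfl rfl).trans
        hb.arrow_eq)

/-- A bead represents its own flag with respect to its own simplex. -/
lemma toBeads_arrow (b : Bead X n) (hb : b.simplex ∈ X.nonDegenerate b.dim) :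
    (toBeads X n).mapArrow.obj b.arrow = Arrow.mk (b.path hb rfl rfl) :=
  (arrow_mk_toBeads_map _ _).trans (represents_flag_arrow b hb).arrow_mk_beadFunctor_map

lemma beadCat_isAtomic_iff {x y : X _⦋0⦌} (f : BeadCat.vertex (n := n) x ⟶ BeadCat.vertex y) :
    IsAtomic f ↔ ∃ (b : Bead X n) (_ : 0 < b.dim) (hb : b.simplex ∈ X.nonDegenerate b.dim)
      (hx : b.source = x) (hy : b.target = y), f = b.path hb hx hy := by
  refine (paths_isAtomic_iff (V := BeadGraph X n) f).trans ⟨?_, ?_⟩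
  · rintro ⟨⟨b, h, hb, hx, hy⟩, rfl⟩
    refine ⟨b, h, hb, hx, hy, ?_⟩
    exact (b.path_of_pos h hb hx hy).symm
  · rintro ⟨b, h, hb, hx, hy, rfl⟩
    refine ⟨⟨b, h, hb, hx, hy⟩, ?_⟩
    exact b.path_of_pos h hb hx hy

lemma beadCat_freeCriterion : FreeCriterion (BeadCat X n) :=
  paths_freeCriterion (V := BeadGraph X n)

lemma ofBeads_comp_toBeads : ofBeads X n ⋙ toBeads X n = 𝟭 _ := by
  refine beadCat_freeCriterion.functor_ext (fun x ↦ toBeads_obj x.as) fun x y f hf ↦ ?_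
  obtain ⟨b, h, hb, hx, hy, rfl⟩ := (beadCat_isAtomic_iff (x := x.as) (y := y.as) f).1 hf
  refine (congrArg (toBeads X n).mapArrow.obj (arrow_mk_ofBeads_map b hb hx hy)).trans ?_
  exact (toBeads_arrow b hb).trans (Bead.arrow_mk_path_eq rfl _ _ _ _ _ _)

end BeadPaths

/-! ### The realization is a simplicial computad -/

section Realization

variable {X : SSet.{u}} {n : ℕ}

lemma realization_freeCriterion : FreeCriterion ((realization.obj X).level n) :=
  .of_inverse toBeads_comp_ofBeads ofBeads_comp_toBeads beadCat_freeCriterion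

lemma vertexObj_bijective : Function.Bijective (vertexObj (X := X) n) := by
  constructor
  · intro x y h
    have := congrArg (toBeads X n).obj h
    rw [toBeads_obj, toBeads_obj] at this
    exact congrArg BeadGraph.as (show BeadGraph.mk (n := n) x = BeadGraph.mk y from this)
  · intro y
    exact ⟨((toBeads X n).obj y).as, Functor.congr_obj toBeads_comp_ofBeads y⟩

lemma isAtomic_bead_arrow (b : Bead X n) (h : 0 < b.dim)
    (hb : b.simplex ∈ X.nonDegenerate b.dim) : IsAtomic b.arrow.hom := by
  rw [← isAtomic_map_iff toBeads_comp_ofBeads ofBeads_comp_toBeads]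
  exact isAtomic_of_arrow_eq (toBeads_arrow b hb).symm
    ((beadCat_isAtomic_iff _).2 ⟨b, h, hb, rfl, rfl, rfl⟩)

lemma exists_bead_of_isAtomic {x y : (realization.obj X).level n} (f : x ⟶ y) (hf : IsAtomic f) :
    ∃ b : Bead X n, 0 < b.dim ∧ b.simplex ∈ X.nonDegenerate b.dim ∧ b.arrow = Arrow.mk f := by
  have hf' := (isAtomic_map_iff toBeads_comp_ofBeads ofBeads_comp_toBeads f).2 hf
  obtain ⟨b, h, hb, hx, hy, e⟩ := (beadCat_isAtomic_iff (x := ((toBeads X n).obj x).as)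
    (y := ((toBeads X n).obj y).as) ((toBeads X n).map f)).1 hf'
  refine ⟨b, h, hb, ?_⟩
  rw [← arrow_mk_ofBeads_map b hb hx hy, ← e]
  exact Functor.congr_obj (congrArg Functor.mapArrow toBeads_comp_ofBeads) (Arrow.mk f)

/-- The last bead of a path of beads. -/
def BeadGraph.last {x y : BeadGraph X n} (p : Quiver.Path x y) : Option (Bead X n) :=
  match p with
  | .nil => none
  | .cons _ e => some e.1

/-- The last bead is an invariant of a path with values in a type independent of the endpoints, so
it can be read off an equality in `Arrow`. -/
lemma Bead.eq_of_path_eq {b b' : Bead X n} (h : 0 < b.dim) (h' : 0 < b'.dim)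
    (hb : b.simplex ∈ X.nonDegenerate b.dim) (hb' : b'.simplex ∈ X.nonDegenerate b'.dim)
    (e : Arrow.mk (b.path hb rfl rfl) = Arrow.mk (b'.path hb' rfl rfl)) : b = b' := by
  rw [b.path_of_pos h, b'.path_of_pos h'] at e
  exact Option.some_injective _
    (congrArg (fun a : Arrow (Paths (BeadGraph X n)) ↦ BeadGraph.last a.hom) e)

lemma bijOn_atomic (X : SSet.{u}) (n : ℕ) : Set.BijOn (Bead.arrow (X := X) (n := n))
    {b | 0 < b.dim ∧ b.simplex ∈ X.nonDegenerate b.dim} ((realization.obj X).atomicArrows n) := by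
  refine ⟨fun b hb ↦ isAtomic_bead_arrow b hb.1 hb.2, fun b hb b' hb' e ↦ ?_, fun f hf ↦ ?_⟩
  · refine Bead.eq_of_path_eq hb.1 hb'.1 hb.2 hb'.2 ?_
    rw [← toBeads_arrow b hb.2, ← toBeads_arrow b' hb'.2, e]
  · obtain ⟨b, h, hb, e⟩ := exists_bead_of_isAtomic f.hom hf
    exact ⟨b, ⟨h, hb⟩, e⟩

/-- Degenerating the arrow of a bead changes only the flag; the simplex stays the same. -/
lemma Bead.exists_act {m n : ℕ} (α : ⦋m⦌ ⟶ ⦋n⦌) [Epi α] (b : Bead X n)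
    {x y : (realization.obj X).level n} (f : x ⟶ y) (e : b.arrow = Arrow.mk f) :
    ∃ F : Flag m b.dim, Arrow.mk F.arrow.{u} =
        Arrow.mk ((coherentSimplex.obj ⦋b.dim⦌).act α b.flag.arrow) ∧
      simplexArrow b.simplex F = Arrow.mk ((realization.obj X).act α f) := by
  obtain ⟨F, hF⟩ := b.flag.exists_act α
  refine ⟨F, hF, ?_⟩
  refine (arrow_map_congr (SCat.levelMap (simplexMap b.simplex) m) hF).trans ?_
  refine (SCat.levelMap_act (simplexMap b.simplex) α b.flag.arrow).trans ?_
  exact arrow_map_congr ((realization.obj X).obj.map α.op).toFunctor e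

lemma isSimplicialComputad_realization (X : SSet.{u}) :
    IsSimplicialComputad (realization.obj X) where
  freely_generated n := realization_freeCriterion.isFreelyGeneratedByAtomics
  atomic_degenerated {m n} α _ x y f hf := by
    obtain ⟨b, h, hb, e⟩ := exists_bead_of_isAtomic f hf
    obtain ⟨F, -, hF⟩ := b.exists_act α f e
    exact isAtomic_of_arrow_eq hF (isAtomic_bead_arrow ⟨b.dim, b.simplex, F⟩ h hb)

/-- If the arrow of `b` is a degeneracy of `g`, then `g` is atomic, hence given by a bead.
Degenerating the flag of that bead yields `b` by injectivity, so the flag of `b` is already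
degenerate in `ℭ[k]`. -/
lemma bead_arrow_mem_nonDegenerateArrows_iff (b : Bead X n) (h : 0 < b.dim)
    (hb : b.simplex ∈ X.nonDegenerate b.dim) :
    b.arrow ∈ (realization.obj X).nonDegenerateArrows n ↔ b.flag.IsProper := by
  rw [b.flag.isProper_iff, ← coherent_mem_nonDegenerate_iff]
  refine ⟨nonDegenerate_of_map (simplexMap b.simplex) b.flag.arrow, fun hF ↦ ?_⟩
  refine (mem_nonDegenerateArrows_iff b.arrow.hom).2 fun m hm α hα x y g e ↦ ?_
  have hg : IsAtomic g := isAtomic_of_act α g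
    (isAtomic_of_arrow_eq e.symm (isAtomic_bead_arrow b h hb))
  obtain ⟨b', h', hb', e'⟩ := exists_bead_of_isAtomic g hg
  obtain ⟨F, hF1, hF2⟩ := b'.exists_act α g e'
  obtain rfl : ⟨b'.dim, b'.simplex, F⟩ = b :=
    (bijOn_atomic X n).injOn ⟨h', hb'⟩ ⟨h, hb⟩ (hF2.trans e)
  exact (mem_nonDegenerateArrows_iff _).1 hF hm α _ hF1.symm

lemma bijOn_atomic_nonDegenerate (X : SSet.{u}) (n : ℕ) :
    Set.BijOn (Bead.arrow (X := X) (n := n))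
      {b | n < b.dim ∧ b.simplex ∈ X.nonDegenerate b.dim ∧ b.flag.IsProper}
      ((realization.obj X).atomicArrows n ∩ (realization.obj X).nonDegenerateArrows n) := by
  have H := bijOn_atomic X n
  refine ⟨fun b ⟨h, hb, hF⟩ ↦ ?_, fun b ⟨h, hb, _⟩ b' ⟨h', hb', _⟩ e ↦ ?_, fun f hf ↦ ?_⟩
  · exact ⟨H.mapsTo ⟨by omega, hb⟩,
      (bead_arrow_mem_nonDegenerateArrows_iff b (by omega) hb).2 hF⟩
  · exact H.injOn ⟨by omega, hb⟩ ⟨by omega, hb'⟩ e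
  · obtain ⟨b, ⟨h, hb⟩, rfl⟩ := H.surjOn hf.1
    have hF := (bead_arrow_mem_nonDegenerateArrows_iff b h hb).1 hf.2
    exact ⟨b, ⟨hF.lt h, hb, hF⟩, rfl⟩

/-! ### Atomic arrows in dimensions zero and one -/

lemma Flag.eq_ofEdge {k : ℕ} (T : Flag 0 k) (hk : 0 < k) : ∃ h : k = 1, h ▸ T = Flag.ofEdge := by
  have h0 : T.T 0 = {0, Fin.last k} := T.last_eq
  have h1 : k = 1 := by
    -- For `n = 0` the flag forces `{0, k} = [0, k]`; since `1` belongs to it and is not `0`, it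
    -- equals `k`.
    have : (⟨1, by omega⟩ : Fin (k + 1)) ∈ T.T 0 := T.zero_eq ▸ Set.mem_univ _
    rw [h0] at this
    rcases this with h | h
    · cases Fin.val_eq_of_eq h
    · exact (Fin.val_eq_of_eq h).symm
  subst h1
  exact ⟨rfl, Flag.ext fun i ↦ (congrArg T.T (Fin.fin_one_eq_zero i)).trans T.zero_eq⟩

lemma Flag.eq_ofSimplex {k : ℕ} (T : Flag 1 k) : T = Flag.ofSimplex k := by
  refine Flag.ext fun i ↦ ?_
  fin_cases i
  · exact T.zero_eq
  · exact T.last_eq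

lemma Flag.isProper_ofSimplex {k : ℕ} (hk : 1 < k) : (Flag.ofSimplex k).IsProper := by
  have h : ({0, Fin.last k} : Set (Fin (k + 1))) < Set.univ := by
    refine Set.ssubset_univ_iff.2 fun h ↦ ?_
    have : (⟨1, by omega⟩ : Fin (k + 1)) ∈ ({0, Fin.last k} : Set _) := h ▸ Set.mem_univ _
    rcases this with h | h
    · cases Fin.val_eq_of_eq h
    · exact hk.ne (Fin.val_eq_of_eq h)
  intro i j hij
  fin_cases i <;> fin_cases j
  · exact absurd hij (by decide)
  · exact h
  · exact absurd hij (by decide)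
  · exact absurd hij (by decide)

lemma bijOn_edges (X : SSet.{u}) :
    Set.BijOn (fun σ : X _⦋1⦌ ↦ simplexArrow σ Flag.ofEdge)
      (X.nonDegenerate 1) ((realization.obj X).atomicArrows 0) := by
  have H := bijOn_atomic X 0
  refine ⟨fun σ hσ ↦ H.mapsTo (x := ⟨1, σ, Flag.ofEdge⟩) ⟨Nat.one_pos, hσ⟩,
    fun σ hσ τ hτ e ↦ ?_, fun f hf ↦ ?_⟩
  · have := H.injOn (x₁ := ⟨1, σ, Flag.ofEdge⟩) (x₂ := ⟨1, τ, Flag.ofEdge⟩)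
      ⟨Nat.one_pos, hσ⟩ ⟨Nat.one_pos, hτ⟩ e
    cases this
    rfl
  · obtain ⟨⟨d, σ, F⟩, ⟨h, hb⟩, rfl⟩ := H.surjOn hf
    obtain ⟨rfl, rfl⟩ := F.eq_ofEdge h
    exact ⟨σ, hb, rfl⟩

lemma bijOn_simplices (X : SSet.{u}) :
    Set.BijOn (fun s : (Σ k : ℕ, X _⦋k⦌) ↦ simplexArrow s.2 (Flag.ofSimplex s.1))
      {s | 1 < s.1 ∧ s.2 ∈ X.nonDegenerate s.1}
      ((realization.obj X).atomicArrows 1 ∩ (realization.obj X).nonDegenerateArrows 1) := by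
  have H := bijOn_atomic_nonDegenerate X 1
  refine ⟨fun s ⟨h, hs⟩ ↦ H.mapsTo (x := ⟨s.1, s.2, Flag.ofSimplex s.1⟩)
    ⟨h, hs, Flag.isProper_ofSimplex h⟩, fun s ⟨h, hs⟩ t ⟨h', ht⟩ e ↦ ?_, fun f hf ↦ ?_⟩
  · have := H.injOn (x₁ := ⟨s.1, s.2, Flag.ofSimplex s.1⟩) (x₂ := ⟨t.1, t.2, Flag.ofSimplex t.1⟩)
      ⟨h, hs, Flag.isProper_ofSimplex h⟩ ⟨h', ht, Flag.isProper_ofSimplex h'⟩ e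
    exact congrArg (fun b : Bead X 1 ↦ (⟨b.dim, b.simplex⟩ : Σ k : ℕ, X _⦋k⦌)) this
  · obtain ⟨⟨d, σ, F⟩, ⟨h, hb, -⟩, rfl⟩ := H.surjOn hf
    obtain rfl := F.eq_ofSimplex
    exact ⟨⟨d, σ⟩, ⟨h, hb⟩, rfl⟩

end Realization

end HomotopyCoherent
end
open HomotopyCoherent Simplicial in
theorem mainTheorem5 (X : SSet.{u}) :
    -- `ℭX` is a simplicial computad
    IsSimplicialComputad (realization.obj X) ∧
    -- its objects are the vertices of `X`
    (∀ n : ℕ, Function.Bijective (vertexObj (X := X) n)) ∧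
    -- the source and target of an arrow given by a simplex with a flag are the initial and
    -- final vertices of the simplex
    (∀ (n k : ℕ) (σ : X _⦋k⦌) (T : Flag n k),
      (simplexArrow σ T).left = vertexObj n (simplexVertex σ 0) ∧
      (simplexArrow σ T).right = vertexObj n (simplexVertex σ (Fin.last k))) ∧
    -- atomic `0`-arrows are the non-degenerate `1`-simplices
    Set.BijOn (fun σ : X _⦋1⦌ ↦ simplexArrow σ Flag.ofEdge)
      (X.nonDegenerate 1) ((realization.obj X).atomicArrows 0) ∧
    -- non-degenerate atomic `1`-arrows are the non-degenerate `k`-simplices, `k > 1`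
    Set.BijOn (fun s : (Σ k : ℕ, X _⦋k⦌) ↦ simplexArrow s.2 (Flag.ofSimplex s.1))
      {s | 1 < s.1 ∧ s.2 ∈ X.nonDegenerate s.1}
      ((realization.obj X).atomicArrows 1 ∩ (realization.obj X).nonDegenerateArrows 1) ∧
    -- non-degenerate atomic `n`-arrows are the non-degenerate `k`-simplices, `k > n`, with a
    -- flag of proper inclusions
    (∀ n : ℕ, Set.BijOn (Bead.arrow (X := X) (n := n))
      {b | n < b.dim ∧ b.simplex ∈ X.nonDegenerate b.dim ∧ b.flag.IsProper}
      ((realization.obj X).atomicArrows n ∩ (realization.obj X).nonDegenerateArrows n)) ∧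
    -- arbitrary atomic `n`-arrows are the non-degenerate `k`-simplices, `k > 0`, with a
    -- flag of not necessarily proper inclusions
    (∀ n : ℕ, Set.BijOn (Bead.arrow (X := X) (n := n))
      {b | 0 < b.dim ∧ b.simplex ∈ X.nonDegenerate b.dim}
      ((realization.obj X).atomicArrows n)) ∧
    -- the flags of proper inclusions are the non-degenerate atomic `n`-arrows of `ℭ[k]` from
    -- `0` to `k`, `k > n`, that are not in the image of any of the face maps
    (∀ n k : ℕ, n < k + 1 → ∀ f : coherentSimplex.vertex.{u} n (0 : Fin (k + 2)) ⟶
        coherentSimplex.vertex n (Fin.last (k + 1)),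
      (IsAtomic f ∧ Arrow.mk f ∈ (coherentSimplex.obj ⦋k + 1⦌).nonDegenerateArrows n ∧
        ∀ i : Fin (k + 2), Arrow.mk f ∉
          Set.range (SCat.levelMap (coherentSimplex.map (SimplexCategory.δ i)) n).mapArrow.obj) ↔
      ∃ T : Flag n (k + 1), T.IsProper ∧ T.arrow = f) :=
  ⟨isSimplicialComputad_realization X, fun _ ↦ vertexObj_bijective,
    fun _ _ σ T ↦ ⟨simplexArrow_left σ T, simplexArrow_right σ T⟩, bijOn_edges X,
    bijOn_simplices X, bijOn_atomic_nonDegenerate X, bijOn_atomic X,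
    fun n k _ f ↦ coherent_atomic_nondegenerate_iff n k f⟩
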